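/- Let $n \ge 0$ and let $\mathbb{D}_n$ be the closed unit disk with a set $P$ of $n$ marked points in its interior. Let $B_n = \operatorname{Mod}(\mathbb{D}_n)$ be the braid group on $n$ strands, i.e. the group of orientation-preserving diffeomorphisms of the disk that fix the boundary pointwise and permute the marked points, modulo isotopies through such diffeomorphisms, and let the pure braid group $PB_n \le B_n$ be the subgroup of mapping classes acting trivially on $P$. Suppose that $\rho : PB_n \to \operatorname{GL}_d(\mathbb{C})$ is a faithful (i.e. injective) linear representation. If $n$ is odd then $d \ge n - 1$. If $n$ is even then $d \ge n - 2$. -/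

import Mathlib

open scoped ContDiff

noncomputable section

namespace Braid

/-- The closed unit disk `𝔻` in the plane. -/
def Disk : Set ℂ := Metric.closedBall 0 1

/-- The `n` marked points `0, 1/(n+1), …, (n-1)/(n+1)`; they are distinct and interior. -/
def mark (n : ℕ) (i : Fin n) : Disk :=
  ⟨(((i : ℝ) / ((n : ℝ) + 1) : ℝ) : ℂ), by
    have h : (i : ℝ) ≤ (n : ℝ) + 1 := by
      have : (i : ℝ) < n := by exact_mod_cast i.isLt
      linarith
    have h0 : (0 : ℝ) ≤ (i : ℝ) / ((n : ℝ) + 1) := by positivity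
    simp only [Disk, mem_closedBall_zero_iff, Complex.norm_real, Real.norm_eq_abs, abs_of_nonneg h0]
    exact div_le_one_of_le₀ h (by positivity)⟩

/-- The set `P` of marked points. -/
def marks (n : ℕ) : Set Disk := Set.range (mark n)

theorem mark_injective (n : ℕ) : Function.Injective (mark n) := by
  intro i j h
  have h1 := congrArg (fun z : Disk => (z : ℂ)) h
  simp only [mark, Complex.ofReal_inj] at h1
  have hn : ((n : ℝ) + 1) ≠ 0 := by positivity
  rw [div_left_inj' hn] at h1
  exact Fin.ext (by exact_mod_cast h1)

theorem mark_interior (n : ℕ) (i : Fin n) : ‖(mark n i : ℂ)‖ < 1 := by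
  have h : (i : ℝ) < (n : ℝ) + 1 := by
    have : (i : ℝ) < n := by exact_mod_cast i.isLt
    linarith
  have h0 : (0 : ℝ) ≤ (i : ℝ) / ((n : ℝ) + 1) := by positivity
  simp only [mark, Complex.norm_real, Real.norm_eq_abs, abs_of_nonneg h0]
  exact (div_lt_one (by positivity)).2 h

/-- A self-map of the closed disk is smooth (up to and including the boundary). -/
def IsSmooth (f : Disk → Disk) : Prop :=
  ∃ F : ℂ → ℂ, ContDiffOn ℝ ∞ F Disk ∧ ∀ z : Disk, F z = f z

theorem IsSmooth.comp {f g : Disk → Disk} (hf : IsSmooth f) (hg : IsSmooth g) :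
    IsSmooth (f ∘ g) := by
  obtain ⟨F, hF, hFf⟩ := hf
  obtain ⟨G, hG, hGg⟩ := hg
  refine ⟨F ∘ G, hF.comp hG ?_, fun z => ?_⟩
  · intro z hz
    have := hGg ⟨z, hz⟩
    simp only at this
    rw [this]
    exact (g ⟨z, hz⟩).2
  · simp [hGg, hFf]

/-- `Diff⁺(𝔻, ∂𝔻)_P`: the diffeomorphisms of the closed disk which fix the boundary pointwise and
permute the marked points. (A diffeomorphism of the disk that fixes the boundary pointwise
preserves the orientation.) -/
def diffGroup (n : ℕ) : Subgroup (Equiv.Perm Disk) where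
  carrier := {f | IsSmooth f ∧ IsSmooth f.symm ∧ (∀ z : Disk, ‖(z : ℂ)‖ = 1 → f z = z) ∧
    f '' marks n = marks n}
  one_mem' := ⟨⟨id, contDiffOn_id, fun _ => rfl⟩, ⟨id, contDiffOn_id, fun _ => rfl⟩,
    fun _ _ => rfl, by simp⟩
  mul_mem' := by
    rintro f g ⟨hf, hf', hfb, hfm⟩ ⟨hg, hg', hgb, hgm⟩
    refine ⟨hf.comp hg, hg'.comp hf', fun z hz => ?_, ?_⟩
    · rw [Equiv.Perm.mul_apply, hgb z hz, hfb z hz]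
    · rw [Equiv.Perm.coe_mul, Set.image_comp, hgm, hfm]
  inv_mem' := by
    rintro f ⟨hf, hf', hfb, hfm⟩
    refine ⟨hf', hf, fun z hz => ?_, ?_⟩
    · rw [Equiv.Perm.inv_eq_iff_eq, hfb z hz]
    · conv_lhs => rw [← hfm]
      rw [← Set.image_comp, ← Equiv.Perm.coe_mul, inv_mul_cancel, Equiv.Perm.coe_one,
        Set.image_id]

/-- `f` is isotopic to the identity: there is a smooth isotopy `H : [0,1] × 𝔻 → 𝔻` from the
identity to `f` through diffeomorphisms that fix the boundary pointwise and permute the marked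
points. -/
def IsotopicToId (n : ℕ) (f : diffGroup n) : Prop :=
  ∃ (H : ℝ × ℂ → ℂ) (φ : ℝ → diffGroup n),
    ContDiffOn ℝ ∞ H (Set.Icc 0 1 ×ˢ Disk) ∧
    (∀ t ∈ Set.Icc (0 : ℝ) 1, ∀ z : Disk, H (t, z) = ((φ t : Equiv.Perm Disk) z : Disk)) ∧
    φ 0 = 1 ∧ φ 1 = f

/-- The normal subgroup of diffeomorphisms isotopic to the identity; `f` and `g` are isotopic
if and only if `f⁻¹ * g` lies in it. -/
def isotopySubgroup (n : ℕ) : Subgroup (diffGroup n) where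
  carrier := {f | IsotopicToId n f}
  one_mem' := ⟨Prod.snd, fun _ => 1, contDiff_snd.contDiffOn, fun _ _ _ => by simp, rfl, rfl⟩
  mul_mem' := by
    rintro f g ⟨H, φ, hH, hφ, h0, h1⟩ ⟨K, ψ, hK, hψ, k0, k1⟩
    refine ⟨fun x => H (x.1, K x), fun t => φ t * ψ t, ?_, ?_, by simp [h0, k0], by simp [h1, k1]⟩
    · refine hH.comp (contDiff_fst.contDiffOn.prodMk hK) ?_
      rintro ⟨t, z⟩ ⟨ht, hz⟩
      refine ⟨ht, ?_⟩
      have := hψ t ht ⟨z, hz⟩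
      simp only at this ⊢
      rw [this]
      exact Subtype.coe_prop _
    · intro t ht z
      simp only [hψ t ht z, hφ t ht]
      rfl
  inv_mem' := by
    rintro f ⟨H, φ, hH, hφ, h0, h1⟩
    obtain ⟨F, hF, hFf⟩ := f.2.2.1
    refine ⟨fun x => H (1 - x.1, F x.2), fun t => φ (1 - t) * f⁻¹, ?_, ?_, by simp [h1],
      by simp [h0]⟩
    · refine hH.comp ((contDiff_const.sub contDiff_fst).contDiffOn.prodMk
        (hF.comp contDiff_snd.contDiffOn fun x hx => hx.2)) ?_
      rintro ⟨t, z⟩ ⟨ht, hz⟩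
      refine ⟨⟨by linarith [ht.2], by linarith [ht.1]⟩, ?_⟩
      have := hFf ⟨z, hz⟩
      simp only at this ⊢
      rw [this]
      exact Subtype.coe_prop _
    · intro t ht z
      have ht' : 1 - t ∈ Set.Icc (0 : ℝ) 1 := ⟨by linarith [ht.2], by linarith [ht.1]⟩
      simp only [hFf z, hφ _ ht']
      rfl

instance isotopySubgroup_normal (n : ℕ) : (isotopySubgroup n).Normal where
  conj_mem := by
    rintro f ⟨H, φ, hH, hφ, h0, h1⟩ g
    obtain ⟨G, hG, hGg⟩ := g.2.1
    obtain ⟨G', hG', hGg'⟩ := g.2.2.1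
    have hG'm : ∀ z ∈ Disk, G' z ∈ Disk := by
      intro z hz
      have := hGg' ⟨z, hz⟩
      simp only at this
      rw [this]
      exact Subtype.coe_prop _
    have hHm : ∀ x ∈ Set.Icc (0 : ℝ) 1 ×ˢ Disk, H x ∈ Disk := by
      rintro ⟨t, z⟩ ⟨ht, hz⟩
      have := hφ t ht ⟨z, hz⟩
      simp only at this
      rw [this]
      exact Subtype.coe_prop _
    refine ⟨fun x => G (H (x.1, G' x.2)), fun t => g * φ t * g⁻¹, ?_, ?_, by simp [h0],
      by simp [h1]⟩
    · refine hG.comp (hH.comp (contDiff_fst.contDiffOn.prodMk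
        (hG'.comp contDiff_snd.contDiffOn fun x hx => hx.2)) ?_) ?_
      · rintro ⟨t, z⟩ ⟨ht, hz⟩
        exact ⟨ht, hG'm z hz⟩
      · rintro ⟨t, z⟩ ⟨ht, hz⟩
        exact hHm _ ⟨ht, hG'm z hz⟩
    · intro t ht z
      simp only [hGg' z, hφ t ht, hGg]
      rfl

/-- The braid group `B_n = Mod(𝔻_n)`, the mapping class group of the disk with `n` marked
points. -/
abbrev BraidGroup (n : ℕ) : Type := diffGroup n ⧸ isotopySubgroup n

theorem apply_mem_marks {n : ℕ} (f : diffGroup n) (z : Disk) :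
    (f : Equiv.Perm Disk) z ∈ marks n ↔ z ∈ marks n := by
  conv_lhs => rw [← f.2.2.2.2]
  exact (f : Equiv.Perm Disk).injective.mem_set_image

/-- The permutation of the marked points induced by a diffeomorphism. -/
def diffPerm (n : ℕ) : diffGroup n →* Equiv.Perm (marks n) where
  toFun f := (f : Equiv.Perm Disk).subtypePerm (apply_mem_marks f)
  map_one' := rfl
  map_mul' _ _ := rfl

theorem diffPerm_eq_one_of_isotopic (n : ℕ) : isotopySubgroup n ≤ (diffPerm n).ker := by
  rintro f ⟨H, φ, hH, hφ, h0, h1⟩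
  rw [MonoidHom.mem_ker]
  ext ⟨z, hz⟩
  have hc : ContinuousOn (fun t : ℝ => H (t, (z : ℂ))) (Set.Icc 0 1) :=
    hH.continuousOn.comp (by fun_prop) fun t ht => ⟨ht, z.2⟩
  have hfin : ((fun z : Disk => (z : ℂ)) '' marks n).Finite := (Set.finite_range _).image _
  have hmaps : Set.MapsTo (fun t : ℝ => H (t, (z : ℂ))) (Set.Icc 0 1)
      ((fun z : Disk => (z : ℂ)) '' marks n) := fun t ht =>
    ⟨(φ t : Equiv.Perm Disk) z, (apply_mem_marks (φ t) z).2 hz, (hφ t ht z).symm⟩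
  have key : H (1, (z : ℂ)) = H (0, (z : ℂ)) :=
    isPreconnected_Icc.constant_of_mapsTo hfin.isDiscrete hc hmaps (by simp) (by simp)
  rw [hφ 1 (by simp) z, hφ 0 (by simp) z, h0, h1] at key
  exact key

/-- The action of the braid group on the set of marked points. -/
def braidPerm (n : ℕ) : BraidGroup n →* Equiv.Perm (marks n) :=
  QuotientGroup.lift (isotopySubgroup n) (diffPerm n) (diffPerm_eq_one_of_isotopic n)

/-- The pure braid group `PB_n = PMod(𝔻_n)`: the mapping classes which act trivially on the set
of marked points. -/
def PureBraidGroup (n : ℕ) : Subgroup (BraidGroup n) := (braidPerm n).ker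

end Braid

end

/-!
A faithful representation of the pure braid group has dimension at least twice the number of
pairwise commuting non-solvable subgroups, and there are `⌊(n - 1) / 2⌋` such subgroups.

The bound is linear algebra, `Representation.two_mul_card_le_finrank_of_not_actsSolvably`. If the
commuting groups have a common invariant subspace, the bound follows from those for the subspace
and the quotient, because an extension of solvable actions is solvable. Otherwise pick one of the
groups and a minimal subspace `E` invariant under all the others. Schur's lemma says that the chosen
group cannot preserve `E`, so some element moves `E` to a complementary subspace, and the dimension
is at least `2 * dim E`; the remaining groups still act non-solvably on `E`.

The subgroups are generated by pairs of full twists. With the marks numbered from `0`, the `l`-th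
pair consists of the twist in an annulus about the marks `0, …, 2 * l + 1` and the twist in an
annulus about the marks `2 * l + 1` and `2 * l + 2`. Annuli belonging to different pairs are
disjoint, so the twists commute (`Braid.commute_of_mem_twistPair`).

To see that a pair generates a non-solvable group, follow the marks `0`, `2 * l + 1`, `2 * l + 2`
only. Extend a pure diffeomorphism `f` to the plane by the identity, and slide the three points `z`
off the disk. The ratio `(z₁ - z₀) / (z₂ - z₀)` of the three points `f (z + 6 * s)`, for `s` from
`0` to `1`, traces a loop in the plane punctured at `0` and `1`. Its class is multiplicative in `f`
and isotopy invariant, which gives `Braid.braidLoopHom`; both facts are homotopies over a square.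
The two twists go to loops about `0` and about `1`. The covering
`TwicePuncturedPlane.bundleCore a b` has monodromy `a` and `b` about the two punctures; with `a` a
transposition and `b` a cycle of length five, the pair surjects onto the symmetric group on five
letters, which is not solvable (`Braid.exists_perm_hom`).
-/

/-! ### Commuting group actions on a vector space -/

namespace Representation

/-- A representation acts solvably if some term of the derived series acts trivially, that is, if
the image of the group is solvable. -/
def ActsSolvably {K G V : Type*} [Field K] [Group G] [AddCommGroup V] [Module K V]
    (σ : Representation K G V) : Prop :=
  ∃ k, ∀ g ∈ derivedSeries G k, σ g = 1

section

variable {K G V : Type*} [Field K] [Group G] [AddCommGroup V] [Module K V]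
  {σ : Representation K G V}

theorem ActsSolvably.of_commute (h : ∀ g g', Commute (σ g) (σ g')) : σ.ActsSolvably := by
  refine ⟨1, fun g hg => ?_⟩
  have hle : derivedSeries G 1 ≤ MonoidHom.ker σ := by
    rw [derivedSeries_succ, Subgroup.commutator_le]
    intro x _ y _
    rw [MonoidHom.mem_ker, commutatorElement_def, map_mul, map_mul, map_mul, (h x y).eq,
      ← map_mul, ← map_mul, ← map_mul]
    simp
  exact hle hg

/-- Elements acting trivially on `W` and on `V ⧸ W` commute with one another, so an extension of
solvable actions is solvable. -/
theorem ActsSolvably.of_sub_of_quotient {W : Submodule K V} (hW : ∀ g, W ≤ W.comap (σ g))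
    (h₁ : (σ.subrepresentation W hW).ActsSolvably) (h₂ : (σ.quotient W hW).ActsSolvably) :
    σ.ActsSolvably := by
  obtain ⟨k₁, h₁⟩ := h₁
  obtain ⟨k₂, h₂⟩ := h₂
  have hsub : ∀ g ∈ derivedSeries G (max k₁ k₂), ∀ w ∈ W, σ g w = w := by
    intro g hg w hw
    have := LinearMap.congr_fun (h₁ g (derivedSeries_antitone G (le_max_left _ _) hg)) ⟨w, hw⟩
    exact congrArg Subtype.val this
  have hquot : ∀ g ∈ derivedSeries G (max k₁ k₂), ∀ v, σ g v - v ∈ W := by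
    intro g hg v
    have := LinearMap.congr_fun (h₂ g (derivedSeries_antitone G (le_max_right _ _) hg))
      (Submodule.Quotient.mk v)
    exact (Submodule.Quotient.eq W).1 this
  have hcomm : ∀ x ∈ derivedSeries G (max k₁ k₂), ∀ y ∈ derivedSeries G (max k₁ k₂),
      σ x * σ y = σ y * σ x := by
    intro x hx y hy
    ext v
    have e₁ := hsub x hx _ (hquot y hy v)
    have e₂ := hsub y hy _ (hquot x hx v)
    rw [map_sub, sub_eq_iff_eq_add] at e₁ e₂
    rw [Module.End.mul_apply, Module.End.mul_apply, e₁, e₂]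
    abel
  refine ⟨max k₁ k₂ + 1, fun g hg => ?_⟩
  have hle : derivedSeries G (max k₁ k₂ + 1) ≤ MonoidHom.ker σ := by
    rw [derivedSeries_succ, Subgroup.commutator_le]
    intro x hx y hy
    rw [MonoidHom.mem_ker, commutatorElement_def, map_mul, map_mul, map_mul, hcomm x hx y hy,
      ← map_mul, ← map_mul, ← map_mul]
    simp
  exact hle hg

end

/-- If pairwise commuting groups act on `V` over an algebraically closed field and none of them
acts solvably, then `V` has dimension at least twice their number. -/
theorem two_mul_card_le_finrank_of_not_actsSolvably {K : Type*} [Field K] [IsAlgClosed K]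
    {ι V : Type*} [Finite ι] [AddCommGroup V] [Module K V] [FiniteDimensional K V]
    {G : ι → Type*} [∀ i, Group (G i)] (σ : ∀ i, Representation K (G i) V)
    (hcomm : ∀ i j, i ≠ j → ∀ g h, Commute (σ i g) (σ j h))
    (hσ : ∀ i, ¬ (σ i).ActsSolvably) :
    2 * Nat.card ι ≤ Module.finrank K V := by
  induction hd : Module.finrank K V using Nat.strong_induction_on generalizing ι V with
  | _ d ih =>
  subst hd
  by_cases hred : ∃ W : Submodule K V, W ≠ ⊥ ∧ W ≠ ⊤ ∧ ∀ i g, W ≤ W.comap (σ i g)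
  · obtain ⟨W, hbot, htop, hW⟩ := hred
    have hlt := Submodule.finrank_lt htop
    have hsum := W.finrank_quotient_add_finrank
    have hpos : 0 < Module.finrank K W :=
      Module.finrank_pos_iff.2 (Submodule.nontrivial_iff_ne_bot.2 hbot)
    have h₁ := ih _ hlt
      (fun i : {i // ¬ ((σ i).subrepresentation W (hW i)).ActsSolvably} =>
        (σ i).subrepresentation W (hW i))
      (fun i j hij g h => LinearMap.ext fun w => Subtype.ext <|
        LinearMap.congr_fun (hcomm i j (fun e => hij (Subtype.ext e)) g h).eq w.1)
      (fun i => i.2) rfl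
    have h₂ := ih (Module.finrank K (V ⧸ W)) (by omega)
      (fun i : {i // ¬ ((σ i).quotient W (hW i)).ActsSolvably} =>
        (σ i).quotient W (hW i))
      (fun i j hij g h => LinearMap.ext fun v => by
        induction v using Submodule.Quotient.induction_on with
        | _ v => exact congrArg Submodule.Quotient.mk (LinearMap.congr_fun
            (hcomm i j (fun e => hij (Subtype.ext e)) g h).eq v))
      (fun i => i.2) rfl
    have hcard : Nat.card ι ≤
        Nat.card {i // ¬ ((σ i).subrepresentation W (hW i)).ActsSolvably} +
        Nat.card {i // ¬ ((σ i).quotient W (hW i)).ActsSolvably} := by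
      rw [← Nat.card_sum]
      have hor : ∀ i, ¬ ((σ i).subrepresentation W (hW i)).ActsSolvably ∨
          ¬ ((σ i).quotient W (hW i)).ActsSolvably := by
        intro i
        by_contra! h
        exact hσ i (.of_sub_of_quotient (hW i) h.1 h.2)
      refine Nat.card_le_card_of_surjective (Sum.elim Subtype.val Subtype.val) fun i => ?_
      exact (hor i).elim (fun h => ⟨Sum.inl ⟨i, h⟩, rfl⟩) fun h => ⟨Sum.inr ⟨i, h⟩, rfl⟩
    omega
  push Not at hred
  rcases isEmpty_or_nonempty ι with hι | ⟨⟨i₀⟩⟩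
  · simp
  have hV : Nontrivial V := by
    by_contra h
    rw [not_nontrivial_iff_subsingleton] at h
    exact hσ i₀ ⟨0, fun g _ => LinearMap.ext fun v => Subsingleton.elim _ _⟩
  -- `E` is a minimal nonzero subspace invariant under all the groups except the one at `i₀`.
  obtain ⟨E, ⟨hE0, hEinv⟩, hEmin⟩ := WellFounded.has_min
    (wellFounded_lt : WellFounded (α := Submodule K V) (· < ·))
    {E : Submodule K V | E ≠ ⊥ ∧ ∀ j, j ≠ i₀ → ∀ g, E ≤ E.comap (σ j g)}
    ⟨⊤, top_ne_bot, fun _ _ _ => le_top⟩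
  have hEmin' : ∀ F : Submodule K V, F ≠ ⊥ → (∀ j, j ≠ i₀ → ∀ g, F ≤ F.comap (σ j g)) →
      F ≤ E → F = E := fun F h0 hF hle => by
    by_contra hne
    exact hEmin F ⟨h0, hF⟩ (lt_of_le_of_ne hle hne)
  have hmove : ∃ g, ¬ E ≤ E.comap (σ i₀ g) := by
    -- Otherwise `E = V` by irreducibility, and by minimality of `E` each element of `G i₀` has a
    -- single eigenspace, hence is a scalar.
    by_contra! hall
    have hEtop : E = ⊤ := by
      by_contra htop
      obtain ⟨i, g, hg⟩ := hred E hE0 htop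
      by_cases hi : i = i₀
      · subst hi; exact hg (hall g)
      · exact hg (hEinv i hi g)
    have hscalar : ∀ g, ∃ μ : K, ∀ v, σ i₀ g v = μ • v := by
      intro g
      obtain ⟨μ, hμ⟩ := Module.End.exists_eigenvalue (σ i₀ g)
      refine ⟨μ, fun v => ?_⟩
      have := hEmin' (Module.End.eigenspace (σ i₀ g) μ) hμ (fun j hj h v hv => by
        rw [Submodule.mem_comap, Module.End.mem_eigenspace_iff] at *
        have := LinearMap.congr_fun (hcomm i₀ j hj.symm g h).eq v
        simp only [Module.End.mul_apply] at this
        rw [this, hv, map_smul]) (hEtop ▸ le_top)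
      have hv : v ∈ Module.End.eigenspace (σ i₀ g) μ := by rw [this, hEtop]; trivial
      exact Module.End.mem_eigenspace_iff.1 hv
    refine hσ i₀ (.of_commute fun g g' => LinearMap.ext fun v => ?_)
    obtain ⟨μ, hμ⟩ := hscalar g
    obtain ⟨ν, hν⟩ := hscalar g'
    rw [Module.End.mul_apply, Module.End.mul_apply, hμ, hν, hμ, hν, smul_comm]
  obtain ⟨g, hg⟩ := hmove
  have hginj : Function.Injective (σ i₀ g) := (σ i₀).apply_bijective g |>.1
  have hrank : Module.finrank K (E.map (σ i₀ g)) = Module.finrank K E :=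
    LinearEquiv.finrank_eq (Submodule.equivMapOfInjective _ hginj E).symm
  have hdisj : E ⊓ E.map (σ i₀ g) = ⊥ := by
    by_contra hne
    have heq := hEmin' _ hne (fun j hj h v hv => by
      obtain ⟨hv₁, w, hw, rfl⟩ := hv
      refine ⟨hEinv j hj h hv₁, σ j h w, hEinv j hj h hw, ?_⟩
      exact LinearMap.congr_fun (hcomm i₀ j hj.symm g h).eq w) inf_le_left
    have := Submodule.eq_of_le_of_finrank_eq (inf_eq_left.1 heq) hrank.symm
    exact hg (Submodule.map_le_iff_le_comap.1 this.ge)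
  have hsum := Submodule.finrank_sup_add_finrank_inf_eq E (E.map (σ i₀ g))
  rw [hdisj, finrank_bot, hrank] at hsum
  have hle := Submodule.finrank_le (E ⊔ E.map (σ i₀ g))
  have hpos : 0 < Module.finrank K E :=
    Module.finrank_pos_iff.2 (Submodule.nontrivial_iff_ne_bot.2 hE0)
  have hEsol : ∀ j (hj : j ≠ i₀),
      ¬ ((σ j).subrepresentation E (hEinv j hj)).ActsSolvably := by
    -- The fixed space of a derived subgroup of `G j` is invariant under all the groups.
    rintro j hj ⟨k, hk⟩
    refine hσ j ⟨k, fun x hx => LinearMap.ext fun v => ?_⟩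
    let T : Submodule K V := ⨅ x : derivedSeries (G j) k, LinearMap.eqLocus (σ j x) 1
    have hT : ∀ v, v ∈ T ↔ ∀ x ∈ derivedSeries (G j) k, σ j x v = v := by
      intro v; simp [T, Submodule.mem_iInf]
    have hET : E ≤ T := fun v hv => (hT v).2 fun x hx =>
      congrArg Subtype.val (LinearMap.congr_fun (hk x hx) ⟨v, hv⟩)
    have hTtop : T = ⊤ := by
      by_contra htop
      obtain ⟨i, y, hy⟩ := hred T (fun h => hE0 (le_bot_iff.1 (h ▸ hET))) htop
      refine hy fun v hv => (hT _).2 fun x hx => ?_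
      rw [hT] at hv
      by_cases hi : i = j
      · subst hi
        have := hv _ ((derivedSeries_normal (G i) k).conj_mem' x hx y)
        rw [map_mul, map_mul, Module.End.mul_apply, Module.End.mul_apply] at this
        conv_rhs => rw [← this]
        rw [self_inv_apply]
      · have := LinearMap.congr_fun (hcomm i j hi y x).eq v
        simp only [Module.End.mul_apply] at this
        rw [← this, hv x hx]
    exact (hT v).1 (hTtop ▸ Submodule.mem_top) x hx
  have hIH := ih _ (by omega) (fun j : {j // j ≠ i₀} => (σ j).subrepresentation E (hEinv j j.2))
    (fun i j hij g h => LinearMap.ext fun w => Subtype.ext <|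
      LinearMap.congr_fun (hcomm i j (fun e => hij (Subtype.ext e)) g h).eq w.1)
    (fun j => hEsol j j.2) rfl
  have hcard : Nat.card {j // j ≠ i₀} + 1 = Nat.card ι := by
    classical
    have := Fintype.ofFinite ι
    have : 0 < Fintype.card ι := Fintype.card_pos_iff.2 ⟨i₀⟩
    simp only [Nat.card_eq_fintype_card, ne_eq, Fintype.card_subtype_compl,
      Fintype.card_subtype_eq]
    omega
  omega

end Representation

noncomputable section

open scoped unitInterval ContDiff

/-! ### Coverings of the twice-punctured plane -/

/-- The plane punctured at `0` and `1`. -/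
abbrev TwicePuncturedPlane : Type := {z : ℂ // z ≠ 0 ∧ z ≠ 1}

namespace TwicePuncturedPlane

variable {S : Type*}

/-- The permutation by which the two charts are glued: trivial on the strip
`0 < re z < 1`, and `a`, `b` to the left and to the right of it. -/
def glue (a b : Equiv.Perm S) (z : TwicePuncturedPlane) : Equiv.Perm S :=
  if z.1.re < 0 then a else if z.1.re < 1 then 1 else b

/-- The plane minus the two closed vertical rays going down (for `true`) or up (for `false`) from
the punctures. -/
def slitPlane : Bool → Set TwicePuncturedPlane
  | true => {z | 0 < z.1.im ∨ (z.1.re ≠ 0 ∧ z.1.re ≠ 1)}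
  | false => {z | z.1.im < 0 ∨ (z.1.re ≠ 0 ∧ z.1.re ≠ 1)}

theorem mem_slitPlane_true {z : TwicePuncturedPlane} (h : 0 ≤ z.1.im) : z ∈ slitPlane true := by
  rcases h.lt_or_eq with h | h
  · exact Or.inl h
  · exact Or.inr ⟨fun h0 => z.2.1 (Complex.ext h0 h.symm), fun h1 => z.2.2 (Complex.ext h1 h.symm)⟩

theorem mem_slitPlane_false {z : TwicePuncturedPlane} (h : z.1.im ≤ 0) : z ∈ slitPlane false := by
  rcases h.lt_or_eq with h | h
  · exact Or.inl h
  · exact Or.inr ⟨fun h0 => z.2.1 (Complex.ext h0 h), fun h1 => z.2.2 (Complex.ext h1 h)⟩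

theorem isOpen_slitPlane (i : Bool) : IsOpen (slitPlane i) := by
  have h1 : Continuous fun z : TwicePuncturedPlane => z.1.re := by fun_prop
  have h2 : Continuous fun z : TwicePuncturedPlane => z.1.im := by fun_prop
  cases i
  · exact (isOpen_lt h2 continuous_const).union
      ((isOpen_ne_fun h1 continuous_const).inter (isOpen_ne_fun h1 continuous_const))
  · exact (isOpen_lt continuous_const h2).union
      ((isOpen_ne_fun h1 continuous_const).inter (isOpen_ne_fun h1 continuous_const))

theorem re_ne_of_mem_slitPlane {z : TwicePuncturedPlane} (h : z ∈ slitPlane true)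
    (h' : z ∈ slitPlane false) : z.1.re ≠ 0 ∧ z.1.re ≠ 1 := by
  rcases h with h | h
  · rcases h' with h' | h'
    · linarith
    · exact h'
  · exact h

theorem eventually_glue_eq (a b : Equiv.Perm S) {z : TwicePuncturedPlane}
    (h : z.1.re ≠ 0 ∧ z.1.re ≠ 1) : ∀ᶠ w in nhds z, glue a b w = glue a b z := by
  have hc : Continuous fun z : TwicePuncturedPlane => z.1.re := by fun_prop
  rcases lt_or_gt_of_ne h.1 with h0 | h0
  · filter_upwards [(isOpen_lt hc continuous_const).mem_nhds h0] with w hw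
    change w.1.re < 0 at hw
    simp [glue, hw, h0]
  · rcases lt_or_gt_of_ne h.2 with h1 | h1
    · filter_upwards [(isOpen_lt hc continuous_const).mem_nhds h1,
        (isOpen_lt continuous_const hc).mem_nhds h0] with w hw hw'
      change w.1.re < 1 at hw
      change 0 < w.1.re at hw'
      simp [glue, hw, hw'.not_gt, h0.not_gt, h1]
    · filter_upwards [(isOpen_lt continuous_const hc).mem_nhds h1] with w hw
      change 1 < w.1.re at hw
      rw [glue, glue, if_neg (by linarith), if_neg (by linarith), if_neg (by linarith),
        if_neg (by linarith)]

variable [TopologicalSpace S] [DiscreteTopology S]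

/-- The bundle with discrete fibre `S` over the twice-punctured plane, trivial over both slit
planes and glued by `a`, `1` and `b` on the three strips in which these overlap. -/
def bundleCore (a b : Equiv.Perm S) : FiberBundleCore Bool TwicePuncturedPlane S where
  baseSet := slitPlane
  isOpen_baseSet := isOpen_slitPlane
  indexAt z := decide (0 ≤ z.1.im)
  mem_baseSet_at z := by
    by_cases h : 0 ≤ z.1.im
    · simpa [h] using mem_slitPlane_true h
    · simpa [h] using mem_slitPlane_false (not_le.1 h).le
  coordChange
    | true, false, z => glue a b z
    | false, true, z => ⇑(glue a b z)⁻¹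
    | _, _, _ => id
  coordChange_self i z _ v := by cases i <;> rfl
  continuousOn_coordChange i j := by
    have key : ∀ c : Equiv.Perm S → S → S,
        ContinuousOn (fun p : TwicePuncturedPlane × S => c (glue a b p.1) p.2)
          ((slitPlane true ∩ slitPlane false) ×ˢ Set.univ) := by
      rintro c ⟨z, s⟩ ⟨⟨h, h'⟩, -⟩
      refine ContinuousAt.continuousWithinAt ?_
      have hc : ContinuousAt (fun p : TwicePuncturedPlane × S => c (glue a b z) p.2) (z, s) :=
        (continuous_of_discreteTopology.comp continuous_snd).continuousAt
      refine hc.congr ?_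
      filter_upwards [continuousAt_fst.eventually
        (eventually_glue_eq a b (re_ne_of_mem_slitPlane h h'))] with p hp
      simp only [hp]
    cases i <;> cases j
    · exact continuousOn_snd
    · rw [Set.inter_comm]; exact key fun g => ⇑g⁻¹
    · exact key fun g => ⇑g
    · exact continuousOn_snd
  coordChange_comp i j k z _ v := by cases i <;> cases j <;> cases k <;> simp

/-- The projection of `bundleCore a b` is a covering map. -/
theorem isCoveringMap_proj (a b : Equiv.Perm S) : IsCoveringMap (bundleCore a b).proj :=
  FiberBundle.isCoveringMap (F := S) (E := (bundleCore a b).Fiber)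

/-- The point over `z` with coordinate `s` in the chart `i`. -/
def chartPoint (a b : Equiv.Perm S) (i : Bool) (z : TwicePuncturedPlane) (s : S) :
    (bundleCore a b).TotalSpace :=
  ⟨z, (bundleCore a b).coordChange i ((bundleCore a b).indexAt z) z s⟩

theorem continuousOn_chartPoint (a b : Equiv.Perm S) (i : Bool) (s : S) :
    ContinuousOn (fun z => chartPoint a b i z s) (slitPlane i) := by
  have h := ((bundleCore a b).localTriv i).continuousOn_invFun
  refine h.comp (f := fun z : TwicePuncturedPlane => (z, s)) (by fun_prop) fun z hz => ?_
  exact ((bundleCore a b).localTriv i).mem_target.2 hz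

theorem chartPoint_true_eq (a b : Equiv.Perm S) {z : TwicePuncturedPlane}
    (h : z ∈ slitPlane true) (h' : z ∈ slitPlane false) (s : S) :
    chartPoint a b true z s = chartPoint a b false z (glue a b z s) := by
  rw [chartPoint, chartPoint]
  congr 1
  exact ((bundleCore a b).coordChange_comp true false ((bundleCore a b).indexAt z) z
    ⟨⟨h, h'⟩, (bundleCore a b).mem_baseSet_at z⟩ s).symm

/-- Points of the fibre over `z`, in terms of their coordinate in the upper chart. -/
def fiberEquiv (a b : Equiv.Perm S) (z : TwicePuncturedPlane) (h : z ∈ slitPlane true) :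
    S ≃ (bundleCore a b).proj ⁻¹' {z} where
  toFun s := ⟨chartPoint a b true z s, rfl⟩
  invFun e := (bundleCore a b).coordChange ((bundleCore a b).indexAt z) true z
    (cast (congrArg (bundleCore a b).Fiber e.2) e.1.2)
  left_inv s := by
    exact ((bundleCore a b).coordChange_comp true _ true z
      ⟨⟨h, (bundleCore a b).mem_baseSet_at z⟩, h⟩ s).trans
      ((bundleCore a b).coordChange_self true _ h _)
  right_inv := by
    rintro ⟨⟨w, s⟩, rfl⟩
    refine Subtype.ext ?_
    change Bundle.TotalSpace.mk _ _ = _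
    congr 1
    exact ((bundleCore a b).coordChange_comp _ true _ w
      ⟨⟨(bundleCore a b).mem_baseSet_at w, h⟩, (bundleCore a b).mem_baseSet_at w⟩ s).trans
      ((bundleCore a b).coordChange_self _ _ ((bundleCore a b).mem_baseSet_at w) _)

/-- The monodromy action of the fundamental group on the fibre `S`, read in the upper chart. -/
def monodromyHom (a b : Equiv.Perm S) (z : TwicePuncturedPlane) (h : z ∈ slitPlane true) :
    FundamentalGroup TwicePuncturedPlane z →* Equiv.Perm S :=
  (fiberEquiv a b z h).symm.permCongrHom.toMonoidHom.comp
    ((isCoveringMap_proj a b).monodromyPerm z)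

/-- A loop based at a point of the strip `0 < re z < 1` which goes through the upper half plane to
`γ (1 / 2)` and comes back through the lower half plane acts by the gluing permutation at
`γ (1 / 2)`. -/
theorem monodromyHom_mk (a b : Equiv.Perm S) {z : TwicePuncturedPlane} (h : z ∈ slitPlane true)
    (h' : z ∈ slitPlane false) (hz : glue a b z = 1) (γ : Path z z) (m : TwicePuncturedPlane)
    (hm : γ ⟨1 / 2, by norm_num, by norm_num⟩ = m)
    (hup : ∀ t : I, (t : ℝ) ≤ 1 / 2 → 0 ≤ (γ t).1.im)
    (hdown : ∀ t : I, 1 / 2 ≤ (t : ℝ) → (γ t).1.im ≤ 0) :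
    monodromyHom a b z h (Path.Homotopic.Quotient.mk γ) = glue a b m := by
  ext s
  have hmid : ∀ t : I, (t : ℝ) = 1 / 2 → γ t = m := by
    intro t ht
    rw [← hm]
    congr 1
    exact Subtype.ext ht
  let Γ : I → (bundleCore a b).TotalSpace := fun t =>
    if (t : ℝ) ≤ 1 / 2 then chartPoint a b true (γ t) s
    else chartPoint a b false (γ t) (glue a b m s)
  have hΓ : Continuous Γ := by
    refine continuous_if_le continuous_subtype_val continuous_const ?_ ?_ ?_
    · exact (continuousOn_chartPoint a b true s).comp γ.continuous.continuousOn
        fun t ht => mem_slitPlane_true (hup t ht)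
    · exact (continuousOn_chartPoint a b false _).comp γ.continuous.continuousOn
        fun t ht => mem_slitPlane_false (hdown t ht)
    · intro t ht
      rw [← hmid t ht]
      exact chartPoint_true_eq a b (mem_slitPlane_true (hup t ht.le))
        (mem_slitPlane_false (hdown t ht.ge)) s
  let P : Path (fiberEquiv a b z h s).1 (fiberEquiv a b z h (glue a b m s)).1 :=
    { toFun := Γ
      continuous_toFun := hΓ
      source' := by
        have : (0 : ℝ) ≤ 1 / 2 := by norm_num
        simp only [Γ, Set.Icc.coe_zero, this, if_true, γ.source]
        rfl
      target' := by
        have : ¬ ((1 : ℝ) ≤ 1 / 2) := by norm_num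
        simp only [Γ, Set.Icc.coe_one, this, if_false, γ.target]
        have e := chartPoint_true_eq a b h h' (glue a b m s)
        rw [hz] at e
        exact e.symm }
  have key : (isCoveringMap_proj a b).monodromyPerm z (Path.Homotopic.Quotient.mk γ)
      (fiberEquiv a b z h s) = fiberEquiv a b z h (glue a b m s) := by
    refine IsCoveringMap.monodromy_eq_of_map_eq (isCoveringMap_proj a b)
      (γ := Path.Homotopic.Quotient.mk γ) (Path.Homotopic.Quotient.mk P) ?_
    refine congrArg Path.Homotopic.Quotient.mk (Path.ext (funext fun t => ?_))
    change (bundleCore a b).proj (Γ t) = γ t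
    simp only [Γ]
    split_ifs <;> rfl
  exact (fiberEquiv a b z h).symm_apply_eq.2 key

end TwicePuncturedPlane

/-! ### The loop of a pure braid and three marked points -/

/-- The diagonal of a square is homotopic to the bottom side followed by the right side. -/
theorem Path.Homotopic.Quotient.mk_diagonal_eq_trans {X : Type*} [TopologicalSpace X]
    {x y z : X} (K : I × I → X) (hK : Continuous K) (δ : Path x z) (β : Path x y) (ρ : Path y z)
    (hδ : ∀ t, δ t = K (t, t)) (hβ : ∀ t, β t = K (t, 0)) (hρ : ∀ t, ρ t = K (1, t)) :
    Path.Homotopic.Quotient.mk δ =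
      (Path.Homotopic.Quotient.mk β).trans (Path.Homotopic.Quotient.mk ρ) := by
  obtain rfl : K (0, 0) = x := by rw [← hδ, δ.source]
  obtain rfl : K (1, 0) = y := by rw [← hβ, β.target]
  obtain rfl : K (1, 1) = z := by rw [← hδ, δ.target]
  let δ' : Path ((0, 0) : I × I) (1, 1) := ⟨⟨fun t => (t, t), by fun_prop⟩, rfl, rfl⟩
  let β' : Path ((0, 0) : I × I) (1, 0) := ⟨⟨fun t => (t, 0), by fun_prop⟩, rfl, rfl⟩
  let ρ' : Path ((1, 0) : I × I) (1, 1) := ⟨⟨fun t => (1, t), by fun_prop⟩, rfl, rfl⟩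
  have h₁ : δ = δ'.map hK := Path.ext (funext hδ)
  have h₂ : β = β'.map hK := Path.ext (funext hβ)
  have h₃ : ρ = ρ'.map hK := Path.ext (funext hρ)
  rw [h₁, h₂, h₃, ← Path.Homotopic.Quotient.mk_trans, ← Path.map_trans]
  have : ContractibleSpace I := (convex_Icc (0 : ℝ) 1).contractibleSpace ⟨0, by simp⟩
  exact Path.Homotopic.Quotient.eq.2
    ((SimplyConnectedSpace.paths_homotopic δ' (β'.trans ρ')).map ⟨K, hK⟩)

/-- The ratio `(z₁ - z₀) / (z₂ - z₀)` attached to three distinct points of the plane. -/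
def simpleRatio (z : Fin 3 ↪ ℂ) : TwicePuncturedPlane :=
  ⟨(z 1 - z 0) / (z 2 - z 0), by
    have h : ∀ i j, i ≠ j → z i - z j ≠ 0 := fun i j hij =>
      sub_ne_zero.2 fun e => hij (z.injective e)
    refine ⟨div_ne_zero (h 1 0 (by decide)) (h 2 0 (by decide)), fun e => ?_⟩
    rw [div_eq_one_iff_eq (h 2 0 (by decide))] at e
    exact h 1 2 (by decide) (by linear_combination e)⟩

theorem simpleRatio_eq_of_add {z w : Fin 3 ↪ ℂ} (c : ℂ) (h : ∀ k, w k = z k + c) :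
    simpleRatio w = simpleRatio z :=
  Subtype.ext (by simp only [simpleRatio, h, add_sub_add_right_eq_sub])

theorem simpleRatio_eq_of_eq {z w : Fin 3 ↪ ℂ} (h : ∀ k, w k = z k) :
    simpleRatio w = simpleRatio z :=
  simpleRatio_eq_of_add 0 (by simpa using h)

theorem continuous_simpleRatio {T : Type*} [TopologicalSpace T] (z : T → Fin 3 ↪ ℂ)
    (h : ∀ k, Continuous fun t => z t k) : Continuous fun t => simpleRatio (z t) := by
  refine Continuous.subtype_mk (((h 1).sub (h 0)).div ((h 2).sub (h 0)) fun t => ?_) _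
  exact sub_ne_zero.2 fun e => absurd ((z t).injective e) (by decide)

/-- The points `z` translated by `6 * s` and then moved by the bijection `F`. The translation takes
the closed unit disk off itself for `s = 1`. -/
def slide (F : Equiv.Perm ℂ) (z : Fin 3 ↪ ℂ) (s : ℝ) : Fin 3 ↪ ℂ :=
  (z.trans (addRightEmbedding (6 * s : ℂ))).trans F.toEmbedding

theorem slide_apply (F : Equiv.Perm ℂ) (z : Fin 3 ↪ ℂ) (s : ℝ) (k : Fin 3) :
    slide F z s k = F (z k + 6 * s) := rfl

/-- If `F` fixes the points `z` and their translates by `6`, then the ratios of the points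
`F (z + 6 * s)` form a loop. -/
def slideLoop (F : Equiv.Perm ℂ) (z : Fin 3 ↪ ℂ) (hF : Continuous F) (h₀ : ∀ k, F (z k) = z k)
    (h₁ : ∀ k, F (z k + 6) = z k + 6) : Path (simpleRatio z) (simpleRatio z) where
  toFun s := simpleRatio (slide F z s)
  continuous_toFun := continuous_simpleRatio _ fun k => by
    simp only [slide_apply]
    exact hF.comp (by fun_prop)
  source' := simpleRatio_eq_of_eq fun k => by simpa [slide_apply] using h₀ k
  target' := simpleRatio_eq_of_add 6 fun k => by simpa [slide_apply] using h₁ k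

theorem one_le_norm_add_six {z : ℂ} (hz : ‖z‖ ≤ 1) : 1 ≤ ‖z + 6‖ := by
  have h : ‖(6 : ℂ)‖ = 6 := by norm_num
  have := norm_sub_norm_le (6 : ℂ) (-z)
  rw [norm_neg, sub_neg_eq_add, add_comm] at this
  rw [add_comm z, add_comm 6 z]
  linarith

/-- If `F s` is a family of bijections of the plane which fix the points outside the open unit disk,
starting at the identity, then the loop of `F 1` is inverse to the loop traced by the points. -/
theorem mk_trans_mk_slideLoop (F : I → Equiv.Perm ℂ) (hF : Continuous fun x : I × ℂ => F x.1 x.2)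
    (hout : ∀ u z, 1 ≤ ‖z‖ → F u z = z) (hzero : F 0 = 1) (z : Fin 3 ↪ ℂ)
    (hz : ∀ k, ‖z k‖ ≤ 1) (hc : Continuous (F 1)) (h₀ : ∀ k, F 1 (z k) = z k)
    (h₁ : ∀ k, F 1 (z k + 6) = z k + 6) (R : Path (simpleRatio z) (simpleRatio z))
    (hR : ∀ u, R u = simpleRatio (z.trans (F u).toEmbedding)) :
    (Path.Homotopic.Quotient.mk R).trans (Path.Homotopic.Quotient.mk (slideLoop (F 1) z hc h₀ h₁))
      = Path.Homotopic.Quotient.mk (Path.refl (simpleRatio z)) := by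
  let K : I × I → TwicePuncturedPlane := fun x => simpleRatio (slide (F x.1) z x.2)
  have hK : Continuous K := continuous_simpleRatio _ fun k => by
    simp only [slide_apply]
    exact hF.comp (f := fun x : I × I => (x.1, z k + 6 * (x.2 : ℝ))) (by fun_prop)
  have hR' : ∀ u, R u = K (u, 0) := fun u => by
    rw [hR]
    exact simpleRatio_eq_of_eq fun k => by simp [slide_apply]
  have hone : ∀ u, simpleRatio z = K (u, 1) := fun u =>
    (simpleRatio_eq_of_add 6 fun k => by
      simpa [slide_apply] using hout u _ (one_le_norm_add_six (hz k))).symm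
  let δ : Path (simpleRatio z) (simpleRatio z) :=
    { toFun := fun t => K (t, t)
      continuous_toFun := hK.comp (by fun_prop)
      source' := by rw [← hR', R.source]
      target' := (hone 1).symm }
  rw [← Path.Homotopic.Quotient.mk_diagonal_eq_trans K hK δ R _ (fun _ => rfl) hR' fun _ => rfl,
    Path.Homotopic.Quotient.mk_diagonal_eq_trans (K ∘ Prod.swap) (hK.comp continuous_swap) δ
      (Path.refl _) (Path.refl _) (fun _ => rfl), ← Path.Homotopic.Quotient.mk_trans]
  · exact Path.Homotopic.Quotient.eq.2 ⟨Path.Homotopy.reflTrans _⟩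
  · intro t
    refine (simpleRatio_eq_of_add (6 * (t : ℝ)) fun k => ?_).symm
    simp [slide_apply, hzero]
  · exact fun t => hone t

/-- The loop of a composition is the composition of the loops. -/
theorem mk_slideLoop_mul (F G FG : Equiv.Perm ℂ) (hmul : FG = F * G) (hF : Continuous F) (hG : Continuous G)
    (hFout : ∀ z, 1 ≤ ‖z‖ → F z = z) (hGout : ∀ z, 1 ≤ ‖z‖ → G z = z)
    (hGin : ∀ z, ‖z‖ ≤ 1 → ‖G z‖ ≤ 1) (z : Fin 3 ↪ ℂ) (hz : ∀ k, ‖z k‖ ≤ 1)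
    (hF₀ : ∀ k, F (z k) = z k) (hF₁ : ∀ k, F (z k + 6) = z k + 6)
    (hG₀ : ∀ k, G (z k) = z k) (hG₁ : ∀ k, G (z k + 6) = z k + 6)
    (hFG : Continuous FG) (hFG₀ : ∀ k, FG (z k) = z k) (hFG₁ : ∀ k, FG (z k + 6) = z k + 6) :
    Path.Homotopic.Quotient.mk (slideLoop FG z hFG hFG₀ hFG₁) =
      (Path.Homotopic.Quotient.mk (slideLoop F z hF hF₀ hF₁)).trans
        (Path.Homotopic.Quotient.mk (slideLoop G z hG hG₀ hG₁)) := by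
  subst hmul
  -- Conjugate `F` and `G` by independent translations, up to an overall translation.
  let q : I × I → Fin 3 ↪ ℂ := fun x =>
    ((slide G z x.2).trans (addRightEmbedding (6 * ((x.1 : ℝ) - (x.2 : ℝ)) : ℂ))).trans
      F.toEmbedding
  have hq : ∀ x k, q x k = F (G (z k + 6 * (x.2 : ℝ)) + 6 * ((x.1 : ℝ) - (x.2 : ℝ))) :=
    fun _ _ => rfl
  refine Path.Homotopic.Quotient.mk_diagonal_eq_trans (fun x => simpleRatio (q x))
    (continuous_simpleRatio _ fun k => ?_) _ _ _ ?_ ?_ ?_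
  · simp only [hq]
    exact hF.comp ((hG.comp (by fun_prop)).add (by fun_prop))
  · exact fun t => simpleRatio_eq_of_eq fun k => by simp [hq, slide_apply]
  · exact fun t => simpleRatio_eq_of_eq fun k => by simp [hq, slide_apply, hG₀]
  · intro t
    refine (simpleRatio_eq_of_add (6 * (1 - (t : ℝ))) fun k => ?_).symm
    rw [hq, slide_apply]
    simp only [Set.Icc.coe_one, Complex.ofReal_one]
    refine hFout _ ?_
    rcases le_total 1 ‖z k + 6 * ((t : ℝ) : ℂ)‖ with h | h
    · rw [hGout _ h]
      convert one_le_norm_add_six (hz k) using 2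
      ring
    · -- Here `z k + 6 * t` has not left the disk, so `t ≤ 1 / 3` and its image moves by at
      -- least `4`.
      have h1 := (Complex.abs_re_le_norm _).trans (hz k)
      have h2 := (Complex.abs_re_le_norm _).trans h
      have h3 := (Complex.abs_re_le_norm _).trans (hGin _ h)
      have h4 := Complex.re_le_norm
        (G (z k + 6 * ((t : ℝ) : ℂ)) + 6 * (1 - ((t : ℝ) : ℂ)))
      simp only [Complex.add_re, Complex.mul_re, Complex.sub_re, Complex.one_re, Complex.ofReal_re,
        Complex.sub_im, Complex.one_im, Complex.ofReal_im, Complex.re_ofNat, Complex.im_ofNat]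
        at h1 h2 h3 h4
      rw [abs_le] at h1 h2 h3
      linarith [h1.1, h2.2, h3.1]

namespace Braid

open Classical in
/-- The action of a diffeomorphism of the disk on the plane, by the identity outside the disk. -/
def planeExt (n : ℕ) : diffGroup n →* Equiv.Perm ℂ :=
  (Equiv.Perm.ofSubtype (p := (· ∈ Disk))).comp (diffGroup n).subtype

variable {n : ℕ}

open Classical in
theorem planeExt_coe (f : diffGroup n) (z : Disk) :
    planeExt n f z = ((f : Equiv.Perm Disk) z : Disk) :=
  Equiv.Perm.ofSubtype_apply_coe _ _

theorem mem_disk_iff {z : ℂ} : z ∈ Disk ↔ ‖z‖ ≤ 1 := mem_closedBall_zero_iff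

open Classical in
theorem planeExt_of_one_le (f : diffGroup n) {z : ℂ} (hz : 1 ≤ ‖z‖) : planeExt n f z = z := by
  rcases hz.lt_or_eq with h | h
  · exact Equiv.Perm.ofSubtype_apply_of_not_mem _ fun hm => (mem_disk_iff.1 hm).not_gt h
  · exact (planeExt_coe f ⟨z, mem_disk_iff.2 h.ge⟩).trans
      (congrArg Subtype.val (f.2.2.2.1 ⟨z, mem_disk_iff.2 h.ge⟩ h.symm))

theorem norm_planeExt_le (f : diffGroup n) {z : ℂ} (hz : ‖z‖ ≤ 1) : ‖planeExt n f z‖ ≤ 1 := by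
  rw [planeExt_coe f ⟨z, mem_disk_iff.2 hz⟩]
  exact mem_disk_iff.1 (Subtype.coe_prop _)

/-- A family of diffeomorphisms which is jointly continuous on the disk extends to a jointly
continuous family on the plane. -/
theorem continuous_planeExt_of_family {T : Type*} [TopologicalSpace T] (φ : T → diffGroup n)
    (H : T × ℂ → ℂ) (hH : ContinuousOn H (Set.univ ×ˢ Disk))
    (hφ : ∀ t (z : Disk), H (t, z) = ((φ t : Equiv.Perm Disk) z : Disk)) :
    Continuous fun x : T × ℂ => planeExt n (φ x.1) x.2 := by
  have heq : ∀ x : T × ℂ, ‖x.2‖ ≤ 1 → planeExt n (φ x.1) x.2 = H x := fun x hx =>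
    (planeExt_coe (φ x.1) ⟨x.2, mem_disk_iff.2 hx⟩).trans (hφ x.1 ⟨x.2, mem_disk_iff.2 hx⟩).symm
  have hite : (fun x : T × ℂ => planeExt n (φ x.1) x.2) =
      fun x => if ‖x.2‖ ≤ 1 then H x else x.2 := by
    funext x
    split_ifs with h
    · exact heq x h
    · exact planeExt_of_one_le _ (not_le.1 h).le
  rw [hite]
  refine continuous_if_le (by fun_prop) continuous_const
    (hH.mono fun x hx => ⟨trivial, mem_disk_iff.2 hx⟩) (by fun_prop) fun x hx => ?_
  rw [← heq x hx.le, planeExt_of_one_le _ hx.ge]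

theorem continuous_planeExt (f : diffGroup n) : Continuous (planeExt n f) := by
  obtain ⟨F, hF, hFf⟩ := f.2.1
  have := continuous_planeExt_of_family (T := Unit) (fun _ => f) (fun x => F x.2)
    (hF.continuousOn.comp (by fun_prop) fun x hx => hx.2) fun _ z => hFf z
  exact this.comp (f := fun z : ℂ => ((), z)) (by fun_prop)

/-- The marked points with the given indices, as points of the plane. -/
def markEmbedding (i : Fin 3 ↪ Fin n) : Fin 3 ↪ ℂ :=
  (i.trans ⟨mark n, mark_injective n⟩).trans (Function.Embedding.subtype _)

theorem norm_markEmbedding_le (i : Fin 3 ↪ Fin n) (k : Fin 3) : ‖markEmbedding i k‖ ≤ 1 :=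
  (mark_interior n (i k)).le

theorem planeExt_markEmbedding (i : Fin 3 ↪ Fin n) {f : diffGroup n} (hf : f ∈ (diffPerm n).ker)
    (k : Fin 3) : planeExt n f (markEmbedding i k) = markEmbedding i k := by
  have h := congrArg Subtype.val
    (DFunLike.congr_fun (MonoidHom.mem_ker.1 hf) ⟨mark n (i k), Set.mem_range_self _⟩)
  exact (planeExt_coe f (mark n (i k))).trans (congrArg Subtype.val h)

theorem planeExt_markEmbedding_add_six (i : Fin 3 ↪ Fin n) (f : diffGroup n) (k : Fin 3) :
    planeExt n f (markEmbedding i k + 6) = markEmbedding i k + 6 :=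
  planeExt_of_one_le f (one_le_norm_add_six (norm_markEmbedding_le i k))

/-- The homotopy class of the loop of the ratios of three marked points under a pure
diffeomorphism. -/
def braidLoop (i : Fin 3 ↪ Fin n) (f : (diffPerm n).ker) :
    FundamentalGroup TwicePuncturedPlane (simpleRatio (markEmbedding i)) :=
  Path.Homotopic.Quotient.mk (slideLoop (planeExt n f) (markEmbedding i) (continuous_planeExt _)
    (planeExt_markEmbedding i f.2) (planeExt_markEmbedding_add_six i _))

theorem braidLoop_mul (i : Fin 3 ↪ Fin n) (f g : (diffPerm n).ker) :
    braidLoop i (f * g) = braidLoop i g * braidLoop i f :=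
  mk_slideLoop_mul (planeExt n f) (planeExt n g) _ (map_mul _ _ _) (continuous_planeExt _)
    (continuous_planeExt _) (fun _ => planeExt_of_one_le _) (fun _ => planeExt_of_one_le _)
    (fun _ => norm_planeExt_le _) (markEmbedding i) (norm_markEmbedding_le i) _ _ _ _ _ _ _

/-- The homomorphism to the fundamental group of the twice-punctured plane which records how a
diffeomorphism braids three of the marked points. The inverse makes up for the order of
multiplication in `FundamentalGroup`. -/
def braidLoopHom (i : Fin 3 ↪ Fin n) :
    (diffPerm n).ker →* FundamentalGroup TwicePuncturedPlane (simpleRatio (markEmbedding i)) :=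
  MonoidHom.mk' (fun f => (braidLoop i f)⁻¹) fun f g => by rw [braidLoop_mul, mul_inv_rev]

/-- If `f` is the end of a continuous family of bijections of the plane supported in the disk and
starting at the identity, then its class is that of the loop of ratios traced by the marked points. -/
theorem braidLoopHom_eq_mk (i : Fin 3 ↪ Fin n) (f : (diffPerm n).ker) (F : I → Equiv.Perm ℂ)
    (hF : Continuous fun x : I × ℂ => F x.1 x.2) (hout : ∀ u z, 1 ≤ ‖z‖ → F u z = z)
    (h₀ : F 0 = 1) (h₁ : F 1 = planeExt n f)
    (R : Path (simpleRatio (markEmbedding i)) (simpleRatio (markEmbedding i)))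
    (hR : ∀ u, R u = simpleRatio ((markEmbedding i).trans (F u).toEmbedding)) :
    braidLoopHom i f = Path.Homotopic.Quotient.mk R := by
  have hc : Continuous (F 1) := h₁ ▸ continuous_planeExt _
  have hfix : ∀ k, F 1 (markEmbedding i k) = markEmbedding i k :=
    h₁ ▸ planeExt_markEmbedding i f.2
  have hfix' : ∀ k, F 1 (markEmbedding i k + 6) = markEmbedding i k + 6 :=
    h₁ ▸ planeExt_markEmbedding_add_six i _
  have hloop : braidLoop i f =
      Path.Homotopic.Quotient.mk (slideLoop (F 1) (markEmbedding i) hc hfix hfix') := by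
    simp only [braidLoop, h₁]
  have h : braidLoop i f * (show FundamentalGroup TwicePuncturedPlane
      (simpleRatio (markEmbedding i)) from Path.Homotopic.Quotient.mk R) = 1 := by
    rw [hloop]
    exact mk_trans_mk_slideLoop F hF hout h₀ (markEmbedding i) (norm_markEmbedding_le i) hc hfix
      hfix' R hR
  exact inv_eq_of_mul_eq_one_right h

/-- `braidLoopHom` factors through the pure braid group. -/
theorem braidLoopHom_eq_one (i : Fin 3 ↪ Fin n) (f : (diffPerm n).ker)
    (hf : (f : diffGroup n) ∈ isotopySubgroup n) : braidLoopHom i f = 1 := by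
  obtain ⟨H, φ, hH, hφ, h₀, h₁⟩ := hf
  have hcont : Continuous fun x : I × ℂ => planeExt n (φ x.1) x.2 :=
    continuous_planeExt_of_family (fun u : I => φ u) (fun x => H (x.1, x.2))
      (hH.continuousOn.comp (by fun_prop) fun x hx => ⟨x.1.2, hx.2⟩) fun t z => hφ t t.2 z
  -- The maps of the isotopy fix the marked points, since their images move continuously in a
  -- finite set.
  have hfix : ∀ (u : I) k, planeExt n (φ u) (markEmbedding i k) = markEmbedding i k := by
    intro u k
    let z := mark n (i k)
    have hc : ContinuousOn (fun t : ℝ => H (t, (z : ℂ))) (Set.Icc 0 1) :=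
      hH.continuousOn.comp (by fun_prop) fun t ht => ⟨ht, z.2⟩
    have hfin : ((fun z : Disk => (z : ℂ)) '' marks n).Finite := (Set.finite_range _).image _
    have hmaps : Set.MapsTo (fun t : ℝ => H (t, (z : ℂ))) (Set.Icc 0 1)
        ((fun z : Disk => (z : ℂ)) '' marks n) := fun t ht =>
      ⟨(φ t : Equiv.Perm Disk) z, (apply_mem_marks (φ t) z).2 (Set.mem_range_self _),
        (hφ t ht z).symm⟩
    have key : H (u, (z : ℂ)) = H (0, (z : ℂ)) :=
      isPreconnected_Icc.constant_of_mapsTo hfin.isDiscrete hc hmaps u.2 (by simp)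
    rw [hφ u u.2 z, hφ 0 (by simp) z, h₀] at key
    exact (planeExt_coe (φ u) z).trans key
  exact braidLoopHom_eq_mk i f (fun u => planeExt n (φ u)) hcont
    (fun _ _ => planeExt_of_one_le _) ((congrArg _ h₀).trans (map_one _)) (congrArg _ h₁) (Path.refl _) fun u =>
    (simpleRatio_eq_of_eq fun k => hfix u k).symm

end Braid

/-! ### Twists -/

/-- The factor by which the twist of angle `α` in the annulus `r ≤ ‖z - c‖ ≤ R` rotates the circle
about `c` through `z`. -/
def twistFactor (c : ℂ) (r R α : ℝ) (z : ℂ) : ℂ :=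
  Complex.exp ((α * Real.smoothTransition ((R ^ 2 - ‖z - c‖ ^ 2) / (R ^ 2 - r ^ 2)) : ℝ) *
    Complex.I)

theorem twistFactor_add (c : ℂ) (r R α β : ℝ) (z : ℂ) :
    twistFactor c r R (α + β) z = twistFactor c r R α z * twistFactor c r R β z := by
  rw [twistFactor, twistFactor, twistFactor, ← Complex.exp_add]
  push_cast
  ring_nf

theorem norm_twistFactor (c : ℂ) (r R α : ℝ) (z : ℂ) : ‖twistFactor c r R α z‖ = 1 :=
  Complex.norm_exp_ofReal_mul_I _

theorem twistFactor_congr (c : ℂ) (r R α : ℝ) {z w : ℂ} (h : ‖z - c‖ = ‖w - c‖) :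
    twistFactor c r R α z = twistFactor c r R α w := by
  rw [twistFactor, twistFactor, h]

theorem norm_twistFactor_mul (c : ℂ) (r R α : ℝ) (z : ℂ) :
    ‖c + twistFactor c r R α z * (z - c) - c‖ = ‖z - c‖ := by
  rw [add_sub_cancel_left, norm_mul, norm_twistFactor, one_mul]

theorem twistFactor_comp (c : ℂ) (r R α β : ℝ) (z : ℂ) :
    c + twistFactor c r R α (c + twistFactor c r R β z * (z - c)) *
      (c + twistFactor c r R β z * (z - c) - c) = c + twistFactor c r R (α + β) z * (z - c) := by
  rw [twistFactor_congr c r R α (norm_twistFactor_mul c r R β z), twistFactor_add]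
  ring

theorem twistFactor_zero (c : ℂ) (r R : ℝ) (z : ℂ) : twistFactor c r R 0 z = 1 := by
  simp [twistFactor]

/-- The twist of angle `α` in the annulus `r ≤ ‖z - c‖ ≤ R`: it rotates the inner disk by `α` and
fixes the points outside the outer circle. -/
def twist (c : ℂ) (r R α : ℝ) : Equiv.Perm ℂ where
  toFun z := c + twistFactor c r R α z * (z - c)
  invFun z := c + twistFactor c r R (-α) z * (z - c)
  left_inv z := by
    change c + _ * (c + _ - c) = z
    rw [twistFactor_comp, neg_add_cancel, twistFactor_zero]; ring
  right_inv z := by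
    change c + _ * (c + _ - c) = z
    rw [twistFactor_comp, add_neg_cancel, twistFactor_zero]; ring

theorem twist_apply (c : ℂ) (r R α : ℝ) (z : ℂ) :
    twist c r R α z = c + twistFactor c r R α z * (z - c) := rfl

theorem twist_symm (c : ℂ) (r R α : ℝ) : (twist c r R α).symm = twist c r R (-α) :=
  Equiv.ext fun _ => rfl

theorem twist_zero (c : ℂ) (r R : ℝ) : twist c r R 0 = 1 := by
  ext z
  rw [twist_apply, twistFactor_zero]
  simp

theorem norm_twist_sub (c : ℂ) (r R α : ℝ) (z : ℂ) : ‖twist c r R α z - c‖ = ‖z - c‖ :=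
  norm_twistFactor_mul c r R α z

section

variable {c : ℂ} {r R : ℝ}

theorem twist_of_le (hr : 0 ≤ r) (hrR : r < R) (α : ℝ) {z : ℂ} (hz : ‖z - c‖ ≤ r) :
    twist c r R α z = c + Complex.exp (α * Complex.I) * (z - c) := by
  have h : 0 < R ^ 2 - r ^ 2 := by nlinarith
  have h' : ‖z - c‖ ^ 2 ≤ r ^ 2 := by gcongr
  rw [twist_apply, twistFactor, Real.smoothTransition.one_of_one_le
    ((one_le_div h).2 (by linarith)), mul_one]

theorem twist_of_ge (hr : 0 ≤ r) (hrR : r < R) (α : ℝ) {z : ℂ} (hz : R ≤ ‖z - c‖) :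
    twist c r R α z = z := by
  have h : 0 < R ^ 2 - r ^ 2 := by nlinarith
  have h' : R ^ 2 ≤ ‖z - c‖ ^ 2 := by gcongr; linarith
  rw [twist_apply, twistFactor, Real.smoothTransition.zero_of_nonpos
    (div_nonpos_of_nonpos_of_nonneg (by linarith) h.le)]
  simp

/-- A full twist only moves points of the open annulus. -/
theorem twist_two_pi_of_notMem (hr : 0 ≤ r) (hrR : r < R) (k : ℤ) {z : ℂ}
    (hz : ‖z - c‖ ≤ r ∨ R ≤ ‖z - c‖) : twist c r R (k * (2 * Real.pi)) z = z := by
  rcases hz with hz | hz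
  · rw [twist_of_le hr hrR _ hz]
    have : Complex.exp (((k * (2 * Real.pi) : ℝ) : ℂ) * Complex.I) = 1 := by
      rw [← Complex.exp_int_mul_two_pi_mul_I k]
      push_cast
      ring_nf
    rw [this]
    ring
  · exact twist_of_ge hr hrR _ hz

theorem norm_twist_le (hr : 0 ≤ r) (hrR : r < R) (hR : ‖c‖ + R ≤ 1) (α : ℝ) {z : ℂ}
    (hz : ‖z‖ ≤ 1) : ‖twist c r R α z‖ ≤ 1 := by
  rcases le_total R ‖z - c‖ with h | h
  · rwa [twist_of_ge hr hrR α h]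
  · have := norm_add_le c (twist c r R α z - c)
    rw [norm_twist_sub, add_sub_cancel] at this
    linarith

theorem twist_of_one_le_norm (hr : 0 ≤ r) (hrR : r < R) (hR : ‖c‖ + R ≤ 1) (α : ℝ) {z : ℂ}
    (hz : 1 ≤ ‖z‖) : twist c r R α z = z :=
  twist_of_ge hr hrR α (by linarith [norm_sub_norm_le z c])

end

theorem contDiff_twist (c : ℂ) (r R α : ℝ) : ContDiff ℝ ∞ (twist c r R α) := by
  have h1 : ContDiff ℝ ∞ fun z : ℂ => (R ^ 2 - ‖z - c‖ ^ 2) / (R ^ 2 - r ^ 2) :=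
    (contDiff_const.sub ((contDiff_id.sub contDiff_const).norm_sq ℝ)).div_const _
  have h2 : ContDiff ℝ ∞ fun z : ℂ =>
      α * Real.smoothTransition ((R ^ 2 - ‖z - c‖ ^ 2) / (R ^ 2 - r ^ 2)) :=
    contDiff_const.mul (Real.smoothTransition.contDiff.comp h1)
  have h3 : ContDiff ℝ ∞ (twistFactor c r R α) :=
    ((Complex.ofRealCLM.contDiff.comp h2).mul contDiff_const).cexp
  exact contDiff_const.add (h3.mul (contDiff_id.sub contDiff_const))

theorem continuous_twist (c : ℂ) (r R : ℝ) :
    Continuous fun x : ℝ × ℂ => twist c r R x.1 x.2 := by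
  simp only [twist_apply, twistFactor]
  have : Continuous fun x : ℝ × ℂ =>
      Real.smoothTransition ((R ^ 2 - ‖x.2 - c‖ ^ 2) / (R ^ 2 - r ^ 2)) :=
    Real.smoothTransition.continuous.comp (by fun_prop)
  fun_prop

/-- Full twists in disjoint annuli commute. -/
theorem commute_twist {c c' : ℂ} {r R r' R' : ℝ} (hr : 0 ≤ r) (hrR : r < R) (hr' : 0 ≤ r')
    (hrR' : r' < R') (h : ∀ z, r < ‖z - c‖ → ‖z - c‖ < R → r' < ‖z - c'‖ → ‖z - c'‖ < R' → False)
    (k k' : ℤ) : Commute (twist c r R (k * (2 * Real.pi))) (twist c' r' R' (k' * (2 * Real.pi))) := by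
  refine Equiv.Perm.Disjoint.commute fun z => ?_
  by_contra! hz
  have h₁ := mt (twist_two_pi_of_notMem hr hrR k) hz.1
  have h₂ := mt (twist_two_pi_of_notMem hr' hrR' k') hz.2
  push Not at h₁ h₂
  exact h z h₁.1 h₁.2 h₂.1 h₂.2

namespace Braid

variable {n : ℕ}

/-- An annulus in the disk that does not meet the marked points, with centre `c` and radii `r` and
`R`. -/
structure MarkAnnulus (n : ℕ) where
  /-- The centre. -/
  c : ℂ
  /-- The inner radius. -/
  r : ℝ
  /-- The outer radius. -/
  R : ℝ
  hr : 0 ≤ r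
  hrR : r < R
  hR : ‖c‖ + R ≤ 1
  hmark : ∀ i, ‖(mark n i : ℂ) - c‖ ≤ r ∨ R ≤ ‖(mark n i : ℂ) - c‖

namespace MarkAnnulus

variable (A : MarkAnnulus n)

theorem twist_mem_disk_iff (α : ℝ) (z : ℂ) : twist A.c A.r A.R α z ∈ Disk ↔ z ∈ Disk := by
  rw [mem_disk_iff, mem_disk_iff]
  refine ⟨fun h => ?_, norm_twist_le A.hr A.hrR A.hR α⟩
  have := norm_twist_le A.hr A.hrR A.hR (-α) h
  rwa [← twist_symm, Equiv.symm_apply_apply] at this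

/-- The twist of angle `α` in the annulus, as a map of the disk. -/
def diskTwist (α : ℝ) : Equiv.Perm Disk :=
  (twist A.c A.r A.R α).subtypePerm (A.twist_mem_disk_iff α)

theorem coe_diskTwist (α : ℝ) (z : Disk) : (A.diskTwist α z : ℂ) = twist A.c A.r A.R α z := rfl

theorem diskTwist_symm (α : ℝ) : (A.diskTwist α).symm = A.diskTwist (-α) := by
  rw [Equiv.symm_eq_iff_trans_eq_refl]
  ext z
  change twist A.c A.r A.R (-α) (twist A.c A.r A.R α z) = z
  rw [← twist_symm, Equiv.symm_apply_apply]

theorem isSmooth_diskTwist (α : ℝ) : IsSmooth (A.diskTwist α) :=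
  ⟨twist A.c A.r A.R α, (contDiff_twist _ _ _ _).contDiffOn, fun z => (A.coe_diskTwist α z).symm⟩

theorem diskTwist_mark (k : ℤ) (i : Fin n) :
    A.diskTwist (k * (2 * Real.pi)) (mark n i) = mark n i :=
  Subtype.ext ((A.coe_diskTwist _ _).trans
    (twist_two_pi_of_notMem A.hr A.hrR k (A.hmark i)))

theorem diskTwist_mem_diffGroup (k : ℤ) : A.diskTwist (k * (2 * Real.pi)) ∈ diffGroup n := by
  refine ⟨A.isSmooth_diskTwist _, ?_, fun z hz => Subtype.ext ?_, ?_⟩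
  · rw [diskTwist_symm]
    exact A.isSmooth_diskTwist _
  · rw [coe_diskTwist]
    exact twist_of_one_le_norm A.hr A.hrR A.hR _ hz.ge
  · rw [marks, ← Set.range_comp]
    exact congrArg Set.range (funext (A.diskTwist_mark k))

/-- The `k`-fold full twist in the annulus, as a pure diffeomorphism of the disk. -/
def fullTwist (k : ℤ) : (diffPerm n).ker :=
  ⟨⟨A.diskTwist (k * (2 * Real.pi)), A.diskTwist_mem_diffGroup k⟩, by
    rw [MonoidHom.mem_ker]
    ext ⟨_, i, rfl⟩
    exact congrArg (fun z : Disk => (z : ℂ)) (A.diskTwist_mark k i)⟩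

open Classical in
theorem planeExt_fullTwist (k : ℤ) :
    planeExt n (A.fullTwist k) = twist A.c A.r A.R (k * (2 * Real.pi)) := by
  refine Equiv.Perm.ofSubtype_subtypePerm (A.twist_mem_disk_iff _) fun z hz => mem_disk_iff.2 ?_
  by_contra! h
  exact hz (twist_of_one_le_norm A.hr A.hrR A.hR _ h.le)

theorem commute_fullTwist {A B : MarkAnnulus n}
    (h : ∀ z, A.r < ‖z - A.c‖ → ‖z - A.c‖ < A.R → B.r < ‖z - B.c‖ → ‖z - B.c‖ < B.R → False)
    (k l : ℤ) : Commute (A.fullTwist k) (B.fullTwist l) := by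
  have hinj : Function.Injective fun f : (diffPerm n).ker => planeExt n f := by
    classical
    exact (Equiv.Perm.ofSubtype_injective.comp Subtype.val_injective).comp Subtype.val_injective
  refine hinj ?_
  simp only [Subgroup.coe_mul, map_mul, planeExt_fullTwist]
  exact commute_twist A.hr A.hrR B.hr B.hrR h k l

open TwicePuncturedPlane in
/-- If the loop of ratios traced by three marked points while the twist is performed starts at a
point of the strip `0 < re z < 1`, goes through the upper half plane to `m`, and returns through
the lower half plane, then the monodromy of the twist is the gluing permutation at `m`. -/
theorem monodromyHom_fullTwist {S : Type*} [TopologicalSpace S] [DiscreteTopology S]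
    (a b : Equiv.Perm S) (i : Fin 3 ↪ Fin n) (k : ℤ)
    (h : simpleRatio (markEmbedding i) ∈ slitPlane true)
    (h' : simpleRatio (markEmbedding i) ∈ slitPlane false)
    (hz : glue a b (simpleRatio (markEmbedding i)) = 1)
    (hup : ∀ t : I, (t : ℝ) ≤ 1 / 2 → 0 ≤ (simpleRatio ((markEmbedding i).trans
      (twist A.c A.r A.R (t * (k * (2 * Real.pi)))).toEmbedding)).1.im)
    (hdown : ∀ t : I, 1 / 2 ≤ (t : ℝ) → (simpleRatio ((markEmbedding i).trans
      (twist A.c A.r A.R (t * (k * (2 * Real.pi)))).toEmbedding)).1.im ≤ 0) :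
    monodromyHom a b _ h (braidLoopHom i (A.fullTwist k)) =
      glue a b (simpleRatio ((markEmbedding i).trans
        (twist A.c A.r A.R (1 / 2 * (k * (2 * Real.pi)))).toEmbedding)) := by
  let R : Path (simpleRatio (markEmbedding i)) (simpleRatio (markEmbedding i)) :=
    { toFun := fun t => simpleRatio ((markEmbedding i).trans
        (twist A.c A.r A.R (t * (k * (2 * Real.pi)))).toEmbedding)
      continuous_toFun := continuous_simpleRatio _ fun j => (continuous_twist A.c A.r A.R).comp
        (f := fun t : I => ((t : ℝ) * (k * (2 * Real.pi)), markEmbedding i j)) (by fun_prop)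
      source' := simpleRatio_eq_of_eq fun j => by
        change twist _ _ _ _ _ = _
        rw [Set.Icc.coe_zero, zero_mul, twist_zero]
        rfl
      target' := simpleRatio_eq_of_eq fun j => by
        change twist _ _ _ _ _ = _
        rw [Set.Icc.coe_one, one_mul]
        exact twist_two_pi_of_notMem A.hr A.hrR k (A.hmark (i j)) }
  rw [braidLoopHom_eq_mk i _ (fun t => twist A.c A.r A.R (t * (k * (2 * Real.pi))))
    ((continuous_twist A.c A.r A.R).comp
      (f := fun x : I × ℂ => ((x.1 : ℝ) * (k * (2 * Real.pi)), x.2)) (by fun_prop))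
    (fun _ _ => twist_of_one_le_norm A.hr A.hrR A.hR _)
    (by rw [Set.Icc.coe_zero, zero_mul, twist_zero])
    (by rw [Set.Icc.coe_one, one_mul, planeExt_fullTwist]) R fun _ => rfl]
  exact monodromyHom_mk a b h h' hz R _ rfl hup hdown

end MarkAnnulus

end Braid

/-! ### Commuting pairs of twists -/

theorem Real.sin_mul_two_pi_nonneg {t : ℝ} (h₀ : 0 ≤ t) (h₁ : t ≤ 1 / 2) :
    0 ≤ Real.sin (t * (2 * Real.pi)) :=
  Real.sin_nonneg_of_nonneg_of_le_pi (by positivity) (by nlinarith [Real.pi_pos])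

theorem Real.sin_mul_two_pi_nonpos {t : ℝ} (h₀ : 1 / 2 ≤ t) (h₁ : t ≤ 1) :
    Real.sin (t * (2 * Real.pi)) ≤ 0 := by
  rw [← Real.sin_sub_two_pi]
  exact Real.sin_nonpos_of_nonpos_of_neg_pi_le (by nlinarith [Real.pi_pos])
    (by nlinarith [Real.pi_pos])

theorem Complex.sub_div_add_im (c w : ℝ) (e : ℂ) :
    (((c : ℂ) - e * w) / ((c : ℂ) + e * w)).im =
      -(2 * c * w * e.im) / Complex.normSq (c + e * w) := by
  rw [Complex.div_im, ← sub_div]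
  simp only [Complex.sub_im, Complex.ofReal_im, Complex.mul_im, Complex.ofReal_re, Complex.add_re,
    Complex.mul_re, Complex.sub_re, Complex.add_im]
  congr 1
  ring

namespace Braid

variable {n : ℕ}

theorem norm_mark_sub (j : Fin n) (x : ℝ) :
    ‖(mark n j : ℂ) - ((x / (n + 1) : ℝ) : ℂ)‖ = |(j : ℝ) - x| / (n + 1) := by
  have h : (0 : ℝ) < n + 1 := by positivity
  rw [mark, ← Complex.ofReal_sub, Complex.norm_real, ← sub_div, Real.norm_eq_abs, abs_div,
    abs_of_pos h]

/-- An annulus centred at the real point `x / (n + 1)`, in units of the distance of the marks. -/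
def unitAnnulus (x r R : ℝ) (hx : 0 ≤ x) (hr : 0 ≤ r) (hrR : r < R) (hR : x + R ≤ n + 1)
    (h : ∀ j : Fin n, |(j : ℝ) - x| ≤ r ∨ R ≤ |(j : ℝ) - x|) : MarkAnnulus n where
  c := ((x / (n + 1) : ℝ) : ℂ)
  r := r / (n + 1)
  R := R / (n + 1)
  hr := by positivity
  hrR := by gcongr
  hR := by
    rw [Complex.norm_real, Real.norm_of_nonneg (by positivity), ← add_div]
    exact div_le_one_of_le₀ hR (by positivity)
  hmark j := by
    rw [norm_mark_sub]
    exact (h j).imp (fun h => by gcongr) fun h => by gcongr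

/-- The annulus about the origin which separates the marks `0, …, 2 * l + 1` from the others. -/
def outerAnnulus (l : ℕ) (hl : 2 * l + 2 < n) : MarkAnnulus n :=
  unitAnnulus 0 (2 * l + 1.4) (2 * l + 1.6) le_rfl (by positivity) (by linarith)
    (by
      have : (2 * l + 2 : ℝ) < n := by exact_mod_cast hl
      linarith)
    fun j => by
      rw [sub_zero, abs_of_nonneg (by positivity)]
      rcases le_or_gt (j : ℕ) (2 * l + 1) with h | h
      · left
        have : (j : ℝ) ≤ 2 * l + 1 := by exact_mod_cast h
        linarith
      · right
        have : (2 * l + 1 : ℝ) + 1 ≤ j := by exact_mod_cast h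
        linarith

/-- The annulus which separates the marks `2 * l + 1` and `2 * l + 2` from the others. -/
def innerAnnulus (l : ℕ) (hl : 2 * l + 2 < n) : MarkAnnulus n :=
  unitAnnulus (2 * l + 1.5) 0.6 0.8 (by positivity) (by norm_num) (by norm_num)
    (by
      have : (2 * l + 2 : ℝ) < n := by exact_mod_cast hl
      linarith)
    fun j => by
      rcases le_or_gt (j : ℕ) (2 * l) with h | h
      · right
        have : (j : ℝ) ≤ 2 * l := by exact_mod_cast h
        rw [abs_sub_comm]
        exact le_trans (by linarith) (le_abs_self _)
      · rcases le_or_gt (j : ℕ) (2 * l + 2) with h' | h'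
        · left
          have h₁ : (2 * l : ℝ) + 1 ≤ j := by exact_mod_cast h
          have h₂ : (j : ℝ) ≤ 2 * l + 2 := by exact_mod_cast h'
          rw [abs_le]
          constructor <;> linarith
        · right
          have : (2 * l + 2 : ℝ) + 1 ≤ j := by exact_mod_cast h'
          exact le_trans (by linarith) (le_abs_self _)

theorem outerAnnulus_cond {l : ℕ} (hl : 2 * l + 2 < n) (z : ℂ)
    (h₁ : (outerAnnulus l hl).r < ‖z - (outerAnnulus l hl).c‖)
    (h₂ : ‖z - (outerAnnulus l hl).c‖ < (outerAnnulus l hl).R) :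
    2 * l + 1.4 < ‖z‖ * (n + 1) ∧ ‖z‖ * (n + 1) < 2 * l + 1.6 := by
  have hn : (0 : ℝ) < n + 1 := by positivity
  simp only [outerAnnulus, unitAnnulus, zero_div, Complex.ofReal_zero, sub_zero] at h₁ h₂
  exact ⟨(div_lt_iff₀ hn).1 h₁, (lt_div_iff₀ hn).1 h₂⟩

theorem innerAnnulus_cond {l : ℕ} (hl : 2 * l + 2 < n) (z : ℂ)
    (h : ‖z - (innerAnnulus l hl).c‖ < (innerAnnulus l hl).R) :
    (2 * l + 0.7 < ‖z‖ * (n + 1) ∧ ‖z‖ * (n + 1) < 2 * l + 2.3) ∧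
    (2 * l + 0.7 < z.re * (n + 1) ∧ z.re * (n + 1) < 2 * l + 2.3) := by
  have hn : (0 : ℝ) < n + 1 := by positivity
  simp only [innerAnnulus, unitAnnulus] at h
  have h₁ := (abs_norm_sub_norm_le z _).trans_lt h
  have h₂ := (Complex.abs_re_le_norm _).trans_lt h
  rw [Complex.norm_real, Real.norm_of_nonneg (by positivity)] at h₁
  rw [Complex.sub_re, Complex.ofReal_re] at h₂
  have key : ∀ y : ℝ, |y - (2 * l + 1.5) / (n + 1)| < 0.8 / (n + 1) →
      2 * l + 0.7 < y * (n + 1) ∧ y * (n + 1) < 2 * l + 2.3 := by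
    intro y hy
    have e : y - (2 * l + 1.5) / (n + 1) = (y * (n + 1) - (2 * l + 1.5)) / (n + 1) := by
      field_simp
    rw [e, abs_div, abs_of_pos hn, div_lt_div_iff_of_pos_right hn, abs_lt] at hy
    constructor <;> linarith [hy.1, hy.2]
  exact ⟨key _ h₁, key _ h₂⟩

/-- The full twists in the outer and in the inner annulus. Their opposite signs make both loops of
ratios pass through the upper half plane first. -/
def twistPair (l : ℕ) (hl : 2 * l + 2 < n) : Set (diffPerm n).ker :=
  {(outerAnnulus l hl).fullTwist 1, (innerAnnulus l hl).fullTwist (-1)}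

theorem commute_of_mem_twistPair {l l' : ℕ} (hl : 2 * l + 2 < n) (hl' : 2 * l' + 2 < n)
    (hne : l ≠ l') {f g : (diffPerm n).ker} (hf : f ∈ twistPair l hl) (hg : g ∈ twistPair l' hl') :
    Commute f g := by
  wlog hlt : l < l' generalizing l l' f g
  · exact (this hl' hl hne.symm hg hf (by omega)).symm
  have hlt' : (l : ℝ) + 1 ≤ l' := by exact_mod_cast hlt
  rcases hf with rfl | rfl <;> rcases hg with rfl | rfl <;>
    refine MarkAnnulus.commute_fullTwist (fun z h₁ h₂ h₃ h₄ => ?_) _ _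
  · linarith [(outerAnnulus_cond hl z h₁ h₂).2, (outerAnnulus_cond hl' z h₃ h₄).1]
  · linarith [(outerAnnulus_cond hl z h₁ h₂).2, (innerAnnulus_cond hl' z h₄).1.1]
  · linarith [(innerAnnulus_cond hl z h₂).1.2, (outerAnnulus_cond hl' z h₃ h₄).1]
  · linarith [(innerAnnulus_cond hl z h₂).2.2, (innerAnnulus_cond hl' z h₄).2.1]

/-- The indices `0`, `2 * l + 1` and `2 * l + 2`. -/
def markTriple (l : ℕ) (hl : 2 * l + 2 < n) : Fin 3 ↪ Fin n where
  toFun := ![⟨0, by omega⟩, ⟨2 * l + 1, by omega⟩, ⟨2 * l + 2, by omega⟩]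
  inj' i j h := by
    fin_cases i <;> fin_cases j <;> simp at h ⊢

section

variable {l : ℕ} (hl : 2 * l + 2 < n)

theorem markEmbedding_markTriple_zero : markEmbedding (markTriple l hl) 0 = 0 := by
  change ((((0 : ℕ) : ℝ) / ((n : ℝ) + 1) : ℝ) : ℂ) = 0
  simp

theorem markEmbedding_markTriple_one :
    markEmbedding (markTriple l hl) 1 = (((2 * l + 1) / (n + 1) : ℝ) : ℂ) := by
  change ((((2 * l + 1 : ℕ) : ℝ) / ((n : ℝ) + 1) : ℝ) : ℂ) = _
  push_cast
  rfl

theorem markEmbedding_markTriple_two :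
    markEmbedding (markTriple l hl) 2 = (((2 * l + 2) / (n + 1) : ℝ) : ℂ) := by
  change ((((2 * l + 2 : ℕ) : ℝ) / ((n : ℝ) + 1) : ℝ) : ℂ) = _
  push_cast
  rfl

theorem simpleRatio_markTriple : (simpleRatio (markEmbedding (markTriple l hl))).1 =
    (((2 * l + 1) / (2 * l + 2) : ℝ) : ℂ) := by
  have hn : ((n : ℝ) + 1) ≠ 0 := by positivity
  change (markEmbedding _ 1 - markEmbedding _ 0) / (markEmbedding _ 2 - markEmbedding _ 0) = _
  rw [markEmbedding_markTriple_zero, markEmbedding_markTriple_one,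
    markEmbedding_markTriple_two, sub_zero, sub_zero, ← Complex.ofReal_div,
    div_div_div_cancel_right₀ hn]

theorem simpleRatio_twist_outerAnnulus (α : ℝ) :
    (simpleRatio ((markEmbedding (markTriple l hl)).trans (twist (outerAnnulus l hl).c
      (outerAnnulus l hl).r (outerAnnulus l hl).R α).toEmbedding)).1 =
    (((2 * l + 1) / (2 * l + 2) : ℝ) : ℂ) * Complex.exp (α * Complex.I) := by
  have hn : (0 : ℝ) < (n : ℝ) + 1 := by positivity
  have hc : (outerAnnulus l hl).c = 0 := by simp [outerAnnulus, unitAnnulus]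
  have e₁ : (outerAnnulus l hl).r = (2 * l + 1.4) / (n + 1) := rfl
  have e₂ : (outerAnnulus l hl).R = (2 * l + 1.6) / (n + 1) := rfl
  have h₀ : twist (outerAnnulus l hl).c (outerAnnulus l hl).r (outerAnnulus l hl).R α 0 = 0 := by
    rw [twist_of_le (outerAnnulus l hl).hr (outerAnnulus l hl).hrR]
    · simp [hc]
    · simpa [hc] using (outerAnnulus l hl).hr
  have h₁ := twist_of_le (c := (outerAnnulus l hl).c) (z := (((2 * l + 1) / (n + 1) : ℝ) : ℂ))
    (outerAnnulus l hl).hr (outerAnnulus l hl).hrR α (by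
      rw [hc, sub_zero, Complex.norm_real, Real.norm_of_nonneg (by positivity), e₁]
      gcongr
      norm_num)
  have h₂ := twist_of_ge (c := (outerAnnulus l hl).c) (z := (((2 * l + 2) / (n + 1) : ℝ) : ℂ))
    (outerAnnulus l hl).hr (outerAnnulus l hl).hrR α (by
      rw [hc, sub_zero, Complex.norm_real, Real.norm_of_nonneg (by positivity), e₂]
      gcongr
      norm_num)
  change (twist _ _ _ α (markEmbedding _ 1) - twist _ _ _ α (markEmbedding _ 0)) /
    (twist _ _ _ α (markEmbedding _ 2) - twist _ _ _ α (markEmbedding _ 0)) = _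
  rw [markEmbedding_markTriple_zero, markEmbedding_markTriple_one, markEmbedding_markTriple_two,
    h₀, h₁, h₂, hc, sub_zero, sub_zero, sub_zero, zero_add, mul_div_assoc, ← Complex.ofReal_div,
    div_div_div_cancel_right₀ hn.ne', mul_comm]

theorem simpleRatio_twist_innerAnnulus (α : ℝ) :
    (simpleRatio ((markEmbedding (markTriple l hl)).trans (twist (innerAnnulus l hl).c
      (innerAnnulus l hl).r (innerAnnulus l hl).R α).toEmbedding)).1 =
    (((2 * l + 1.5 : ℝ) : ℂ) - Complex.exp (α * Complex.I) * (0.5 : ℝ)) /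
      (((2 * l + 1.5 : ℝ) : ℂ) + Complex.exp (α * Complex.I) * (0.5 : ℝ)) := by
  have hn : (0 : ℝ) < (n : ℝ) + 1 := by positivity
  have hn' : ((n : ℂ) + 1) ≠ 0 := by exact_mod_cast hn.ne'
  have hc : (innerAnnulus l hl).c = (((2 * l + 1.5) / (n + 1) : ℝ) : ℂ) := rfl
  have e₁ : (innerAnnulus l hl).r = 0.6 / (n + 1) := rfl
  have e₂ : (innerAnnulus l hl).R = 0.8 / (n + 1) := rfl
  have h₀ : twist (innerAnnulus l hl).c (innerAnnulus l hl).r (innerAnnulus l hl).R α 0 = 0 := by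
    refine twist_of_ge (innerAnnulus l hl).hr (innerAnnulus l hl).hrR _ ?_
    rw [hc, zero_sub, norm_neg, Complex.norm_real, Real.norm_of_nonneg (by positivity), e₂]
    gcongr
    linarith [(Nat.cast_nonneg l : (0 : ℝ) ≤ l)]
  have h₁ := twist_of_le (c := (innerAnnulus l hl).c) (z := (((2 * l + 1) / (n + 1) : ℝ) : ℂ))
    (innerAnnulus l hl).hr (innerAnnulus l hl).hrR α (by
      rw [hc, ← Complex.ofReal_sub, Complex.norm_real, ← sub_div, Real.norm_eq_abs, abs_div,
        abs_of_pos hn, e₁]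
      gcongr
      rw [abs_le]
      constructor <;> linarith)
  have h₂ := twist_of_le (c := (innerAnnulus l hl).c) (z := (((2 * l + 2) / (n + 1) : ℝ) : ℂ))
    (innerAnnulus l hl).hr (innerAnnulus l hl).hrR α (by
      rw [hc, ← Complex.ofReal_sub, Complex.norm_real, ← sub_div, Real.norm_eq_abs, abs_div,
        abs_of_pos hn, e₁]
      gcongr
      rw [abs_le]
      constructor <;> linarith)
  change (twist _ _ _ α (markEmbedding _ 1) - twist _ _ _ α (markEmbedding _ 0)) /
    (twist _ _ _ α (markEmbedding _ 2) - twist _ _ _ α (markEmbedding _ 0)) = _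
  rw [markEmbedding_markTriple_zero, markEmbedding_markTriple_one, markEmbedding_markTriple_two,
    h₀, h₁, h₂, hc, sub_zero, sub_zero, ← mul_div_mul_left _ _ hn']
  congr 1
  · push_cast
    field_simp
    ring
  · push_cast
    field_simp
    ring

theorem simpleRatio_markTriple_re :
    0 < (simpleRatio (markEmbedding (markTriple l hl))).1.re ∧
    (simpleRatio (markEmbedding (markTriple l hl))).1.re < 1 := by
  rw [simpleRatio_markTriple, Complex.ofReal_re]
  exact ⟨by positivity, (div_lt_one (by positivity)).2 (by linarith)⟩

open TwicePuncturedPlane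

theorem simpleRatio_markTriple_mem (i : Bool) :
    simpleRatio (markEmbedding (markTriple l hl)) ∈ slitPlane i := by
  have h : (simpleRatio (markEmbedding (markTriple l hl))).1.im = 0 := by
    rw [simpleRatio_markTriple, Complex.ofReal_im]
  cases i
  · exact mem_slitPlane_false h.le
  · exact mem_slitPlane_true h.ge

variable {S : Type*} (a b : Equiv.Perm S)

theorem glue_simpleRatio_markTriple :
    glue a b (simpleRatio (markEmbedding (markTriple l hl))) = 1 := by
  rw [glue, if_neg (simpleRatio_markTriple_re hl).1.not_gt, if_pos (simpleRatio_markTriple_re hl).2]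

variable [TopologicalSpace S] [DiscreteTopology S]

/-- Under the outer twist the ratio runs around `0` inside the unit circle. -/
theorem monodromyHom_outerAnnulus :
    monodromyHom a b _ (simpleRatio_markTriple_mem hl true)
      (braidLoopHom (markTriple l hl) ((outerAnnulus l hl).fullTwist 1)) = a := by
  have him : ∀ t : ℝ, (simpleRatio ((markEmbedding (markTriple l hl)).trans
      (twist (outerAnnulus l hl).c (outerAnnulus l hl).r (outerAnnulus l hl).R
        (t * ((1 : ℤ) * (2 * Real.pi)))).toEmbedding)).1.im =
      (2 * l + 1) / (2 * l + 2) * Real.sin (t * (2 * Real.pi)) := by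
    intro t
    rw [simpleRatio_twist_outerAnnulus, Complex.im_ofReal_mul, Complex.exp_ofReal_mul_I_im,
      Int.cast_one, one_mul]
  rw [MarkAnnulus.monodromyHom_fullTwist _ a b _ 1 _ (simpleRatio_markTriple_mem hl false)
    (glue_simpleRatio_markTriple hl a b)]
  · rw [glue, if_pos]
    rw [simpleRatio_twist_outerAnnulus]
    have : ((1 / 2 * ((1 : ℤ) * (2 * Real.pi)) : ℝ) : ℂ) = Real.pi := by push_cast; ring
    rw [this, Complex.exp_pi_mul_I, mul_neg_one, Complex.neg_re, Complex.ofReal_re]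
    exact neg_lt_zero.2 (by positivity)
  · intro t ht
    rw [him]
    exact mul_nonneg (by positivity) (Real.sin_mul_two_pi_nonneg t.2.1 ht)
  · intro t ht
    rw [him]
    exact mul_nonpos_of_nonneg_of_nonpos (by positivity) (Real.sin_mul_two_pi_nonpos ht t.2.2)

/-- Under the inner twist, the ratio `(c - e * w) / (c + e * w)` with `e` on the unit circle and
`w < c` runs around `1`. -/
theorem monodromyHom_innerAnnulus :
    monodromyHom a b _ (simpleRatio_markTriple_mem hl true)
      (braidLoopHom (markTriple l hl) ((innerAnnulus l hl).fullTwist (-1))) = b := by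
  have him : ∀ t : ℝ, ∃ C : ℝ, 0 ≤ C ∧ (simpleRatio ((markEmbedding (markTriple l hl)).trans
      (twist (innerAnnulus l hl).c (innerAnnulus l hl).r (innerAnnulus l hl).R
        (t * ((-1 : ℤ) * (2 * Real.pi)))).toEmbedding)).1.im =
      C * Real.sin (t * (2 * Real.pi)) := by
    intro t
    refine ⟨2 * (2 * l + 1.5) * 0.5 / Complex.normSq (((2 * l + 1.5 : ℝ) : ℂ) +
      Complex.exp ((t * ((-1 : ℤ) * (2 * Real.pi)) : ℝ) * Complex.I) * (0.5 : ℝ)),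
      div_nonneg (by positivity) (Complex.normSq_nonneg _), ?_⟩
    have : t * (((-1 : ℤ) : ℝ) * (2 * Real.pi)) = -(t * (2 * Real.pi)) := by push_cast; ring
    rw [simpleRatio_twist_innerAnnulus, Complex.sub_div_add_im, Complex.exp_ofReal_mul_I_im, this,
      Real.sin_neg]
    ring
  rw [MarkAnnulus.monodromyHom_fullTwist _ a b _ (-1) _ (simpleRatio_markTriple_mem hl false)
    (glue_simpleRatio_markTriple hl a b)]
  · have : ((1 / 2 * ((-1 : ℤ) * (2 * Real.pi)) : ℝ) : ℂ) = -Real.pi := by push_cast; ring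
    have h : 1 < (simpleRatio ((markEmbedding (markTriple l hl)).trans
        (twist (innerAnnulus l hl).c (innerAnnulus l hl).r (innerAnnulus l hl).R
          (1 / 2 * ((-1 : ℤ) * (2 * Real.pi)))).toEmbedding)).1.re := by
      rw [simpleRatio_twist_innerAnnulus, this, neg_mul, Complex.exp_neg, Complex.exp_pi_mul_I,
        inv_neg_one, neg_one_mul, ← Complex.ofReal_neg, ← Complex.ofReal_sub, ← Complex.ofReal_add,
        ← Complex.ofReal_div, Complex.ofReal_re]
      have hl0 : (0 : ℝ) ≤ l := Nat.cast_nonneg l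
      exact (one_lt_div (by linarith)).2 (by linarith)
    rw [glue, if_neg (by linarith), if_neg (by linarith)]
  · intro t ht
    obtain ⟨C, hC, h⟩ := him t
    rw [h]
    exact mul_nonneg hC (Real.sin_mul_two_pi_nonneg t.2.1 ht)
  · intro t ht
    obtain ⟨C, hC, h⟩ := him t
    rw [h]
    exact mul_nonpos_of_nonneg_of_nonpos hC (Real.sin_mul_two_pi_nonpos ht t.2.2)

end

/-! ### Representations of the pure braid group -/

/-- The pure mapping class of a diffeomorphism which fixes the marked points. -/
def pureClass (n : ℕ) : (diffPerm n).ker →* PureBraidGroup n :=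
  ((QuotientGroup.mk' (isotopySubgroup n)).comp (diffPerm n).ker.subtype).codRestrict _
    fun f => f.2

theorem mem_isotopySubgroup_of_pureClass_eq_one {f : (diffPerm n).ker} (h : pureClass n f = 1) :
    (f : diffGroup n) ∈ isotopySubgroup n :=
  (QuotientGroup.eq_one_iff _).1 (congrArg Subtype.val h)

/-- The subgroup generated by a pair of twists surjects onto the symmetric group on five letters, by
a homomorphism which is trivial on diffeomorphisms isotopic to the identity. -/
theorem exists_perm_hom {l : ℕ} (hl : 2 * l + 2 < n) :
    ∃ ψ : (diffPerm n).ker →* Equiv.Perm (Fin 5),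
      (∀ f, pureClass n f = 1 → ψ f = 1) ∧
      (Subgroup.closure (twistPair l hl)).map ψ = ⊤ := by
  refine ⟨(TwicePuncturedPlane.monodromyHom (Equiv.swap 0 (finRotate 5 0)) (finRotate 5) _
    (simpleRatio_markTriple_mem hl true)).comp (braidLoopHom (markTriple l hl)), fun f hf => ?_, ?_⟩
  · rw [MonoidHom.comp_apply, braidLoopHom_eq_one _ f (mem_isotopySubgroup_of_pureClass_eq_one hf),
      map_one]
  · rw [MonoidHom.map_closure, twistPair, Set.image_pair, MonoidHom.comp_apply,
      MonoidHom.comp_apply, monodromyHom_outerAnnulus, monodromyHom_innerAnnulus, Set.pair_comm]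
    exact Equiv.Perm.closure_cycle_adjacent_swap isCycle_finRotate support_finRotate 0

/-- A faithful representation of the pure braid group has dimension at least twice the number of
the commuting pairs of twists. -/
theorem two_mul_le_of_injective {m d : ℕ} (hm : 2 * m < n)
    (ρ : PureBraidGroup n →* Matrix.GeneralLinearGroup (Fin d) ℂ) (hρ : Function.Injective ρ) :
    2 * m ≤ d := by
  let τ : Matrix.GeneralLinearGroup (Fin d) ℂ →* Module.End ℂ (Fin d → ℂ) :=
    (Matrix.toLinAlgEquiv' : Matrix (Fin d) (Fin d) ℂ ≃ₐ[ℂ] _).toMonoidHom.comp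
      (Units.coeHom _)
  have hτ : Function.Injective τ := Matrix.toLinAlgEquiv'.injective.comp Units.val_injective
  have hl : ∀ l : Fin m, 2 * (l : ℕ) + 2 < n := fun l => by omega
  let H : Fin m → Subgroup (diffPerm n).ker := fun l => Subgroup.closure (twistPair l (hl l))
  let θ : ∀ l, Representation ℂ (H l) (Fin d → ℂ) := fun l =>
    ((τ.comp ρ).comp (pureClass n)).comp (H l).subtype
  have hcomm : ∀ l l', l ≠ l' → ∀ (g : H l) (h : H l'), Commute (θ l g) (θ l' h) := by
    intro l l' hne g h
    have hle : H l ≤ Subgroup.centralizer (H l') := by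
      rw [Subgroup.closure_le]
      intro f hf
      rw [SetLike.mem_coe, Subgroup.centralizer_closure, Subgroup.mem_centralizer_iff]
      exact fun f' hf' => (commute_of_mem_twistPair (hl l) (hl l')
        (fun e => hne (Fin.ext e)) hf hf').symm.eq
    have hgh : Commute (g : (diffPerm n).ker) h :=
      (Subgroup.mem_centralizer_iff.1 (hle g.2) h h.2).symm
    exact hgh.map ((τ.comp ρ).comp (pureClass n))
  have hsol : ∀ l, ¬ (θ l).ActsSolvably := by
    rintro l ⟨k, hk⟩
    obtain ⟨ψ, hψ, htop⟩ := exists_perm_hom (hl l)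
    refine Equiv.Perm.not_isSolvable_fin_5 ((Group.isSolvable_def _).2 ⟨k, ?_⟩)
    have hsurj : Function.Surjective (ψ.comp (H l).subtype) := by
      rw [← MonoidHom.range_eq_top, MonoidHom.range_comp, Subgroup.range_subtype]
      exact htop
    rw [← map_derivedSeries_eq hsurj, Subgroup.map_eq_bot_iff]
    intro g hg
    refine hψ _ (hρ (hτ ?_))
    rw [map_one, map_one]
    exact hk g hg
  have := Representation.two_mul_card_le_finrank_of_not_actsSolvably θ hcomm hsol
  simpa using this

end Braid

end

theorem mainTheorem4 (n d : ℕ) (ρ : Braid.PureBraidGroup n →* Matrix.GeneralLinearGroup (Fin d) ℂ)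
    (hρ : Function.Injective ρ) :
    (Odd n → (n : ℤ) - 1 ≤ (d : ℤ)) ∧ (Even n → (n : ℤ) - 2 ≤ (d : ℤ)) := by
  have h (m : ℕ) (hm : 2 * m < n) : 2 * m ≤ d := Braid.two_mul_le_of_injective hm ρ hρ
  refine ⟨?_, ?_⟩
  · rintro ⟨k, hk⟩
    have := h k (by omega)
    omega
  · rintro ⟨k, hk⟩
    rcases Nat.eq_zero_or_pos k with hk0 | hk0
    · omega
    · have := h (k - 1) (by omega)
      omega
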